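/- All graphs are finite and simple; $\mathbb{N}=\{1,2,\dots\}$ and $[n]=\{1,\dots,n\}$. A *path* (resp. *cycle*) in a graph $G$ is an induced subgraph of $G$ that is a path with at least one vertex (resp. a cycle); its *length* is its number of edges. Write $\partial P$ for the set of ends of a path $P$ and $P^*=P\setminus\partial P$ for its interior. Two sets of vertices are *anticomplete* if $G$ has no edge between them. A graph $G$ *contains* a graph $H$ if some induced subgraph of $G$ is isomorphic to $H$. For $c,o\in\mathbb{N}$, a graph $G$ is *$(c,o)$-perforated* if there are no $c$ pairwise disjoint and pairwise anticomplete cycles in $G$, each of length at least $o+2$. A *plain $(\sigma,\lambda)$-constellation* in $G$ is a pair $(S,\mathcal{L})$ where $\mathcal{L}$ is a set of $\lambda$ pairwise disjoint and pairwise anticomplete paths in $G$, and $S$ is a stable set of $\sigma$ vertices, disjoint from all paths in $\mathcal{L}$, such that every vertex of $S$ has a neighbor in every path of $\mathcal{L}$. For an integer $s\ge 0$, an *ordered $s$-asterism* in $G$ consists of a stable set $S$ with $|S|=s$, a path $L$ in $G\setminus S$ such that every vertex of $S$ has a neighbor in $L^*$ and $S$ is anticomplete to $\partial L$, and a bijection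 $\pi:[s]\to S$. For $X\subseteq S$, an *$X$-piece* is a path $P$ of non-zero length contained in $L$ such that every end of $P$ that is not an end of $L$ has a neighbor in $X$, and $P^*$ is anticomplete to $X$; it is *closed* if its two ends have a common neighbor in $X$, and *open* otherwise. For $o\in\mathbb{N}$, a *full $(s,o)$-occultation* in $G$ is an ordered $s$-asterism in $G$ such that - no two vertices of $S$ have a common neighbor in $L$; and - for every $i\in[s]$, the vertex $\pi(i)$ has a neighbor in every open $\pi([i-1])$-piece, and in every closed $\pi([i-1])$-piece of length at least $o$. **Theorem 6.1.** For all $c,o,t\in\mathbb{N}$ and every integer $s\ge 0$, there are constants $\Sigma=\Sigma(c,o,s,t)\in\mathbb{N}\cup\{0\}$ and $\Lambda=\Lambda(c,o,s,t)\in\mathbb{N}$ such that for every $(c,o)$-perforated graph $G$, if there is a plain $(\Sigma,\Lambda)$-constellation in $G$, then $G$ contains $K_t$ or $K_{t,t}$, or there is a full $(s,o)$-occultation in $G$. -/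

import Mathlib

namespace PerforatedGraphs

universe u

variable {V : Type u}

/-- A path in `G`: an induced subgraph of `G` that is a path. It has at least one vertex, and
its vertices are listed in the order in which they are traversed. -/
structure InducedPath (G : SimpleGraph V) where
  /-- the number of edges -/
  length : ℕ
  toEmb : SimpleGraph.pathGraph (length + 1) ↪g G

/-- A cycle in `G`: an induced subgraph of `G` that is a cycle. -/
structure InducedCycle (G : SimpleGraph V) where
  /-- the number of edges, equivalently of vertices -/
  length : ℕ
  three_le : 3 ≤ length
  toEmb : SimpleGraph.cycleGraph length ↪g G

namespace InducedPath

variable {G : SimpleGraph V}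

/-- The vertex set of a path. -/
def verts (P : InducedPath G) : Set V := Set.range P.toEmb

/-- The set of ends of a path (one vertex if the path has length zero). -/
def ends (P : InducedPath G) : Set V := {P.toEmb 0, P.toEmb (Fin.last P.length)}

/-- The interior of a path. -/
def interior (P : InducedPath G) : Set V := P.verts \ P.ends

end InducedPath

/-- The vertex set of a cycle. -/
def InducedCycle.verts {G : SimpleGraph V} (H : InducedCycle G) : Set V := Set.range H.toEmb

/-- There is no edge of `G` between `X` and `Y`. -/
def Anticomplete (G : SimpleGraph V) (X Y : Set V) : Prop :=
  ∀ x ∈ X, ∀ y ∈ Y, ¬ G.Adj x y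

/-- The vertex `x` has a neighbor in `X`. -/
def HasNeighborIn (G : SimpleGraph V) (x : V) (X : Set V) : Prop :=
  ∃ y ∈ X, G.Adj x y

/-- `G` is `(c,o)`-perforated: no induced subgraph of `G` is the disjoint union of `c` cycles,
each of length at least `o + 2`. -/
def IsPerforated (G : SimpleGraph V) (c o : ℕ) : Prop :=
  ¬ ∃ H : Fin c → InducedCycle G,
    (∀ i, o + 2 ≤ (H i).length) ∧
    ∀ i j, i ≠ j →
      Disjoint (H i).verts (H j).verts ∧ Anticomplete G (H i).verts (H j).verts

/-- An `(s,l)`-constellation in `G`: a stable set of `s` vertices together with `l` pairwise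
disjoint paths in `G`, none of which meets the stable set, such that every vertex of the stable
set has a neighbor in every one of the paths. -/
structure Constellation (G : SimpleGraph V) (s l : ℕ) where
  S : Finset V
  paths : Fin l → InducedPath G
  card_S : S.card = s
  stable : G.IsIndepSet (S : Set V)
  paths_disjoint : ∀ i j, i ≠ j → Disjoint (paths i).verts (paths j).verts
  S_disjoint : ∀ i, Disjoint (S : Set V) (paths i).verts
  hasNeighbor : ∀ x ∈ S, ∀ i, HasNeighborIn G x (paths i).verts

/-- A constellation is plain if its paths are pairwise anticomplete. -/
def Constellation.IsPlain {G : SimpleGraph V} {s l : ℕ} (C : Constellation G s l) : Prop :=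
  ∀ i j, i ≠ j → Anticomplete G (C.paths i).verts (C.paths j).verts

/-- For a path `L` in `G` and a set `X` of vertices, `P` is a piece of `(X, L)`: a path in `L`
of non-zero length, each end of which is an end of `L` or has a neighbor in `X`, and whose
interior is anticomplete to `X`. -/
def IsPiece (G : SimpleGraph V) (X : Set V) (L P : InducedPath G) : Prop :=
  P.verts ⊆ L.verts ∧ 0 < P.length ∧
  (∀ v ∈ P.ends, v ∉ L.ends → HasNeighborIn G v X) ∧
  Anticomplete G P.interior X

/-- A closed piece of `(X, L)`: the two ends have a common neighbor in `X`. -/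
def IsClosedPiece (G : SimpleGraph V) (X : Set V) (L P : InducedPath G) : Prop :=
  IsPiece G X L P ∧ ∃ x ∈ X, ∀ v ∈ P.ends, G.Adj x v

/-- An open piece of `(X, L)`: the two ends have no common neighbor in `X`. -/
def IsOpenPiece (G : SimpleGraph V) (X : Set V) (L P : InducedPath G) : Prop :=
  IsPiece G X L P ∧ ¬ ∃ x ∈ X, ∀ v ∈ P.ends, G.Adj x v

/-- An ordered `s`-asterism in `G`: a stable set of `s` vertices, enumerated by the injection
`π`, and a path `L` in `G` disjoint from it, such that every vertex of the stable set has a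
neighbor in the interior of `L` and none has a neighbor among the ends of `L`. -/
structure OrderedAsterism (G : SimpleGraph V) (s : ℕ) where
  π : Fin s ↪ V
  L : InducedPath G
  stable : G.IsIndepSet (Set.range π)
  disjoint : Disjoint (Set.range π) L.verts
  hasNeighbor : ∀ i, HasNeighborIn G (π i) L.interior
  anticomplete_ends : Anticomplete G (Set.range π) L.ends

namespace OrderedAsterism

variable {G : SimpleGraph V} {s : ℕ}

/-- The set of vertices of the stable set that come strictly before the one with index `i`. -/
def before (a : OrderedAsterism G s) (i : Fin s) : Set V := a.π '' {j | j < i}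

/-- No two vertices of the stable set have a common neighbor in the path. -/
def IsAmple (a : OrderedAsterism G s) : Prop :=
  ∀ i j, i ≠ j → ∀ v ∈ a.L.verts, ¬ (G.Adj (a.π i) v ∧ G.Adj (a.π j) v)

/-- Each vertex of the stable set has a neighbor in every open piece created by its
predecessors. -/
def IsInterrupted (a : OrderedAsterism G s) : Prop :=
  ∀ i, ∀ P : InducedPath G, IsOpenPiece G (a.before i) a.L P → HasNeighborIn G (a.π i) P.verts

/-- Each vertex of the stable set has a neighbor in every closed piece of length at least `o`
created by its predecessors. -/
def IsInvaded (a : OrderedAsterism G s) (o : ℕ) : Prop :=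
  ∀ i, ∀ P : InducedPath G, IsClosedPiece G (a.before i) a.L P → o ≤ P.length →
    HasNeighborIn G (a.π i) P.verts

/-- A full `(s,o)`-occultation. -/
def IsFullOccultation (a : OrderedAsterism G s) (o : ℕ) : Prop :=
  a.IsAmple ∧ a.IsInterrupted ∧ a.IsInvaded o

end OrderedAsterism

end PerforatedGraphs

/-! Fix a path and a vertex set. A link between `y` and `z` is a segment of the path on which `y`
sees only one end and `z` only the other; a hole of `y` is a segment on which `y` sees exactly the
two ends. Links joined cyclically on distinct paths, and holes closed up by their vertex, are
induced cycles. Perforation therefore forbids many links or holes that avoid the other vertices.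

Pigeonhole over hitting patterns makes many paths look alike. Free-set and Ramsey arguments then
show that links and holes hit by few vertices can be eliminated by passing to a large subsystem
(`exists_stable_of_linked`, `exists_large_of_holes`). Applied to single vertices, viewed as links of
length zero, this makes the system ample unless an induced `K_{t,t}` appears; this is why a clique
is never needed.

In an ample system, some vertex `d` interrupts a large subsystem, that is, hits all its links and
holes on suitable segments (`exists_interrupter`). Otherwise one can always pass to segments that
miss any bounded set of vertices and are still hit by many others. Long cycles can then be extracted
one at a time, each separated from the earlier ones, until there are `c` of them.

Iterating inside the interrupted subsystem yields a sequence, each term of which interrupts its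
predecessors, and a segment that is a link between the first two terms. That segment is the path of
the occultation. The first two terms are left out of the stable set; they only mark the two ends of
the path, so that every open piece is a link and every closed piece of length at least `o` a hole.
-/

namespace PerforatedGraphs

universe u

variable {V : Type u}

/-! ### Ramsey-type tools -/

open Classical in
/-- The finite Ramsey theorem for graphs, for a symmetric relation on a finset. -/
theorem exists_clique_or_stable (a b : ℕ) : ∃ N : ℕ, ∀ {α : Type*} (r : α → α → Prop)
    (_ : ∀ u v, r u v → r v u) (X : Finset α), N ≤ X.card →
    (∃ Y ⊆ X, a ≤ Y.card ∧ ∀ u ∈ Y, ∀ v ∈ Y, u ≠ v → r u v) ∨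
    (∃ Y ⊆ X, b ≤ Y.card ∧ ∀ u ∈ Y, ∀ v ∈ Y, u ≠ v → ¬ r u v) := by
  induction a generalizing b with
  | zero => exact ⟨0, fun r _ X _ => Or.inl ⟨∅, by simp, by simp, by simp⟩⟩
  | succ a iha =>
    induction b with
    | zero => exact ⟨0, fun r _ X _ => Or.inr ⟨∅, by simp, by simp, by simp⟩⟩
    | succ b ihb =>
      obtain ⟨N₁, h₁⟩ := iha (b + 1)
      obtain ⟨N₂, h₂⟩ := ihb
      refine ⟨N₁ + N₂ + 1, fun r hr X hX => ?_⟩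
      obtain ⟨z, hz⟩ : X.Nonempty := Finset.card_pos.mp (by omega)
      have hc : ((X.erase z).filter (fun u => r z u)).card +
          ((X.erase z).filter (fun u => ¬ r z u)).card = (X.erase z).card :=
        Finset.card_filter_add_card_filter_not _
      have he := Finset.card_erase_add_one hz
      have hsub : ∀ (p : _ → Prop) [DecidablePred p], (X.erase z).filter p ⊆ X := fun p _ =>
        (Finset.filter_subset _ _).trans (Finset.erase_subset _ _)
      rcases le_or_gt N₁ ((X.erase z).filter (fun u => r z u)).card with h | h
      · rcases h₁ r hr _ h with ⟨Y, hY, hc, hq⟩ | ⟨Y, hY, hc, hq⟩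
        · refine Or.inl ⟨insert z Y, ?_, ?_, ?_⟩
          · exact Finset.insert_subset hz (hY.trans (hsub _))
          · rw [Finset.card_insert_of_notMem]
            · omega
            · intro hzY
              simpa using hY hzY
          · intro u hu v hv huv
            rcases Finset.mem_insert.mp hu with rfl | hu' <;>
              rcases Finset.mem_insert.mp hv with rfl | hv'
            · exact absurd rfl huv
            · exact (Finset.mem_filter.mp (hY hv')).2
            · exact hr _ _ (Finset.mem_filter.mp (hY hu')).2
            · exact hq u hu' v hv' huv
        · exact Or.inr ⟨Y, hY.trans (hsub _), hc, hq⟩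
      · rcases h₂ r hr ((X.erase z).filter (fun u => ¬ r z u)) (by omega) with
          ⟨Y, hY, hc, hq⟩ | ⟨Y, hY, hc, hq⟩
        · exact Or.inl ⟨Y, hY.trans (hsub _), hc, hq⟩
        · refine Or.inr ⟨insert z Y, ?_, ?_, ?_⟩
          · exact Finset.insert_subset hz (hY.trans (hsub _))
          · rw [Finset.card_insert_of_notMem]
            · omega
            · intro hzY
              simpa using hY hzY
          · intro u hu v hv huv
            rcases Finset.mem_insert.mp hu with rfl | hu' <;>
              rcases Finset.mem_insert.mp hv with rfl | hv'
            · exact absurd rfl huv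
            · exact (Finset.mem_filter.mp (hY hv')).2
            · exact fun h => (Finset.mem_filter.mp (hY hu')).2 (hr _ _ h)
            · exact hq u hu' v hv' huv

open Classical in
/-- A set mapping with small images has a large free set. -/
theorem exists_free_set (m n : ℕ) : ∃ N : ℕ, ∀ {α : Type*} (X : Finset α) (f : α → Finset α),
    (∀ u ∈ X, (f u).card ≤ m) → N ≤ X.card →
    ∃ Y ⊆ X, n ≤ Y.card ∧ ∀ u ∈ Y, ∀ v ∈ Y, u ≠ v → v ∉ f u := by
  induction m generalizing n with
  | zero =>
    refine ⟨n, fun X f hf hX => ⟨X, subset_rfl, hX, fun u hu v _ _ => ?_⟩⟩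
    rw [Finset.card_eq_zero.mp (Nat.le_zero.mp (hf u hu))]
    simp
  | succ m ihm =>
    induction n with
    | zero => exact ⟨0, fun X f _ _ => ⟨∅, by simp, by simp, by simp⟩⟩
    | succ n ihn =>
      obtain ⟨N₁, h₁⟩ := ihm (n + 1)
      obtain ⟨N₂, h₂⟩ := ihn
      refine ⟨N₁ + N₂ + (m + 1) + 1, fun X f hf hX => ?_⟩
      obtain ⟨z, hz⟩ : X.Nonempty := Finset.card_pos.mp (by omega)
      have hc : ((X.erase z).filter (fun u => z ∈ f u)).card +
          ((X.erase z).filter (fun u => z ∉ f u)).card = (X.erase z).card :=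
        Finset.card_filter_add_card_filter_not _
      have he := Finset.card_erase_add_one hz
      have hsub : ∀ (p : _ → Prop) [DecidablePred p], (X.erase z).filter p ⊆ X := fun p _ =>
        (Finset.filter_subset _ _).trans (Finset.erase_subset _ _)
      -- If `z` lies in many images, keep only those elements and delete `z` from their images,
      -- which lowers the bound to `m`. Otherwise keep the elements outside `f z` whose images avoid
      -- `z`, and add `z` to the free set found there.
      rcases le_or_gt N₁ ((X.erase z).filter (fun u => z ∈ f u)).card with h | h
      · obtain ⟨Y, hY, hc, hq⟩ := h₁ ((X.erase z).filter (fun u => z ∈ f u))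
          (fun u => (f u).erase z) (fun u hu => by
            have hu' := Finset.mem_filter.mp hu
            have := hf u (hsub _ hu)
            rw [Finset.card_erase_of_mem hu'.2]
            omega) h
        refine ⟨Y, hY.trans (hsub _), hc, fun u hu v hv huv hvf => hq u hu v hv huv ?_⟩
        refine Finset.mem_erase.mpr ⟨?_, hvf⟩
        rintro rfl
        simpa using hY hv
      · have hd := Finset.le_card_sdiff (f z) ((X.erase z).filter (fun u => z ∉ f u))
        have := hf z hz
        obtain ⟨Y, hY, hc, hq⟩ := h₂ ((X.erase z).filter (fun u => z ∉ f u) \ f z) f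
          (fun u hu => hf u (hsub _ (Finset.sdiff_subset hu))) (by omega)
        refine ⟨insert z Y, ?_, ?_, ?_⟩
        · exact Finset.insert_subset hz (hY.trans (Finset.sdiff_subset.trans (hsub _)))
        · rw [Finset.card_insert_of_notMem]
          · omega
          · intro hzY
            simpa using hY hzY
        · intro u hu v hv huv
          rcases Finset.mem_insert.mp hu with rfl | hu' <;>
            rcases Finset.mem_insert.mp hv with rfl | hv'
          · exact absurd rfl huv
          · exact (Finset.mem_sdiff.mp (hY hv')).2
          · exact (Finset.mem_filter.mp (Finset.mem_sdiff.mp (hY hu')).1).2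
          · exact hq u hu' v hv' huv

open Classical in
/-- A symmetric set mapping on pairs with small images has a large free set. -/
theorem exists_free_set_pairs (m n : ℕ) : ∃ N : ℕ, ∀ {α : Type*} (X : Finset α)
    (f : α → α → Finset α), (∀ u v, f u v = f v u) →
    (∀ u ∈ X, ∀ v ∈ X, u ≠ v → (f u v).card ≤ m) → N ≤ X.card →
    ∃ Y ⊆ X, n ≤ Y.card ∧
      ∀ u ∈ Y, ∀ v ∈ Y, ∀ w ∈ Y, u ≠ v → w ≠ u → w ≠ v → w ∉ f u v := by
  induction m generalizing n with
  | zero =>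
    refine ⟨n, fun X f _ hf hX => ⟨X, subset_rfl, hX, fun u hu v hv w _ huv _ _ => ?_⟩⟩
    rw [Finset.card_eq_zero.mp (Nat.le_zero.mp (hf u hu v hv huv))]
    simp
  | succ m ihm =>
    induction n with
    | zero => exact ⟨0, fun X f _ _ _ => ⟨∅, by simp, by simp, by simp⟩⟩
    | succ n ihn =>
      obtain ⟨N₁, h₁⟩ := ihm (n + 1)
      obtain ⟨N₂, h₂⟩ := ihn
      obtain ⟨N₃, h₃⟩ := exists_free_set (m + 1) N₂
      obtain ⟨N, hN⟩ := exists_clique_or_stable N₁ N₃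
      refine ⟨N + 1, fun X f hs hf hX => ?_⟩
      obtain ⟨z, hz⟩ : X.Nonempty := Finset.card_pos.mp (by omega)
      have he := Finset.card_erase_add_one hz
      -- Pairs are coloured by whether their image contains `z`. On a clique, deleting `z` lowers
      -- the bound. A stable set can be joined by `z` once it is also free for the mapping `f z`,
      -- which handles the pairs through `z`.
      rcases hN (fun u v => z ∈ f u v) (fun u v h => by rwa [hs v u]) (X.erase z) (by omega) with
        ⟨Y, hY, hc, hq⟩ | ⟨Y, hY, hc, hq⟩
      · have hYX := hY.trans (Finset.erase_subset _ _)
        obtain ⟨Y', hY', hc', hq'⟩ := h₁ Y (fun u v => (f u v).erase z)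
          (fun u v => by rw [hs u v]) (fun u hu v hv huv => by
            have := hf u (hYX hu) v (hYX hv) huv
            rw [Finset.card_erase_of_mem (hq u hu v hv huv)]
            omega) hc
        refine ⟨Y', hY'.trans hYX, hc', fun u hu v hv w hw huv hwu hwv hwf =>
          hq' u hu v hv w hw huv hwu hwv (Finset.mem_erase.mpr ⟨?_, hwf⟩)⟩
        rintro rfl
        simpa using hY (hY' hw)
      · have hYX := hY.trans (Finset.erase_subset _ _)
        have hzY : ∀ u ∈ Y, z ≠ u := by
          rintro u hu rfl
          simpa using hY hu
        obtain ⟨Y', hY', hc', hq'⟩ := h₃ Y (f z)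
          (fun u hu => hf z hz u (hYX hu) (hzY u hu)) hc
        obtain ⟨Y'', hY'', hc'', hq''⟩ := h₂ Y' f hs
          (fun u hu v hv => hf u (hYX (hY' hu)) v (hYX (hY' hv))) hc'
        refine ⟨insert z Y'', ?_, ?_, ?_⟩
        · exact Finset.insert_subset hz (hY''.trans (hY'.trans hYX))
        · rw [Finset.card_insert_of_notMem]
          · omega
          · exact fun h => hzY z (hY' (hY'' h)) rfl
        · intro u hu v hv w hw huv hwu hwv
          rcases Finset.mem_insert.mp hu with rfl | hu' <;>
            rcases Finset.mem_insert.mp hv with rfl | hv' <;>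
            rcases Finset.mem_insert.mp hw with rfl | hw'
          · exact absurd rfl huv
          · exact absurd rfl huv
          · exact absurd rfl hwu
          · exact hq' v (hY'' hv') w (hY'' hw') hwv.symm
          · exact absurd rfl hwv
          · rw [hs]
            exact hq' u (hY'' hu') w (hY'' hw') hwu.symm
          · exact hq u (hY' (hY'' hu')) v (hY' (hY'' hv')) huv
          · exact hq'' u hu' v hv' w hw' huv hwu hwv

open Classical in
/-- The pigeonhole principle: some value is taken `k` times. -/
theorem exists_large_fiber {ι β : Type*} (J : Finset ι) (T : Finset β) (φ : ι → β) (k : ℕ)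
    (hφ : ∀ j ∈ J, φ j ∈ T) (hT : T.Nonempty) (h : T.card * k ≤ J.card) :
    ∃ J' ⊆ J, ∃ b ∈ T, k ≤ J'.card ∧ ∀ j ∈ J', φ j = b := by
  obtain ⟨b, hb, hk⟩ := Finset.exists_le_card_fiber_of_mul_le_card_of_maps_to hφ hT h
  exact ⟨_, Finset.filter_subset _ _, b, hb, hk, fun j hj => (Finset.mem_filter.mp hj).2⟩

/-- A finset with at least `N` elements contains `N` terms of an injective sequence. -/
theorem exists_seq_of_le_card {α : Type*} (X : Finset α) (N : ℕ) (hN : 0 < N) (h : N ≤ X.card) :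
    ∃ e : ℕ → α, (∀ i < N, e i ∈ X) ∧ ∀ i < N, ∀ j < N, e i = e j → i = j := by
  have hX : 0 < X.card := by omega
  refine ⟨fun i => X.equivFin.symm ⟨min i (X.card - 1), by omega⟩, fun i _ => by simp, ?_⟩
  intro i hi j hj hij
  have := congrArg Fin.val (X.equivFin.symm.injective (Subtype.ext hij))
  simp only at this
  omega

/-! ### Induced paths as sequences, and the cycles they close up to -/

/-- `v 0, …, v n` are the vertices of an induced path, in order. -/
def IsPathSeq (G : SimpleGraph V) (v : ℕ → V) (n : ℕ) : Prop :=
  (∀ p ≤ n, ∀ q ≤ n, v p = v q → p = q) ∧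
  ∀ p ≤ n, ∀ q ≤ n, G.Adj (v p) (v q) ↔ p + 1 = q ∨ q + 1 = p

theorem isPathSeq_zero (G : SimpleGraph V) (v : ℕ → V) : IsPathSeq G v 0 :=
  ⟨fun p hp q hq _ => by omega, fun p hp q hq => by
    obtain rfl : p = 0 := by omega
    obtain rfl : q = 0 := by omega
    simp⟩

theorem IsPathSeq.shift {G : SimpleGraph V} {v : ℕ → V} {n a b : ℕ} (h : IsPathSeq G v n)
    (hb : b ≤ n) : IsPathSeq G (fun p => v (a + p)) (b - a) ∨ b < a := by
  rcases lt_or_ge b a with hab | hab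
  · exact Or.inr hab
  · refine Or.inl ⟨fun p hp q hq e => ?_, fun p hp q hq => ?_⟩
    · have := h.1 _ (by omega) _ (by omega) e
      omega
    · rw [h.2 _ (by omega) _ (by omega)]
      omega

theorem IsPathSeq.reverse {G : SimpleGraph V} {v : ℕ → V} {n : ℕ} (h : IsPathSeq G v n) :
    IsPathSeq G (fun p => v (n - p)) n := by
  refine ⟨fun p hp q hq e => ?_, fun p hp q hq => ?_⟩
  · have := h.1 _ (by omega) _ (by omega) e
    omega
  · rw [h.2 _ (by omega) _ (by omega)]
    omega

/-- Concatenation of sequences, the first one being indexed by `0, …, n`. -/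
def seqAppend (v : ℕ → V) (n : ℕ) (w : ℕ → V) : ℕ → V :=
  fun p => if p ≤ n then v p else w (p - n - 1)

theorem seqAppend_left {v w : ℕ → V} {n p : ℕ} (h : p ≤ n) : seqAppend v n w p = v p :=
  if_pos h

theorem seqAppend_right {v w : ℕ → V} {n p : ℕ} (h : n < p) :
    seqAppend v n w p = w (p - n - 1) :=
  if_neg (by omega)

theorem IsPathSeq.append {G : SimpleGraph V} {v w : ℕ → V} {n m : ℕ} (hv : IsPathSeq G v n)
    (hw : IsPathSeq G w m) (hne : ∀ p ≤ n, ∀ q ≤ m, v p ≠ w q)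
    (hadj : ∀ p ≤ n, ∀ q ≤ m, G.Adj (v p) (w q) ↔ p = n ∧ q = 0) :
    IsPathSeq G (seqAppend v n w) (n + 1 + m) := by
  refine ⟨fun p hp q hq e => ?_, fun p hp q hq => ?_⟩ <;>
    rcases le_or_gt p n with h₁ | h₁ <;> rcases le_or_gt q n with h₂ | h₂
  · rw [seqAppend_left h₁, seqAppend_left h₂] at e
    exact hv.1 p h₁ q h₂ e
  · rw [seqAppend_left h₁, seqAppend_right h₂] at e
    exact absurd e (hne _ h₁ _ (by omega))
  · rw [seqAppend_right h₁, seqAppend_left h₂] at e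
    exact absurd e.symm (hne _ h₂ _ (by omega))
  · rw [seqAppend_right h₁, seqAppend_right h₂] at e
    have := hw.1 _ (by omega) _ (by omega) e
    omega
  · rw [seqAppend_left h₁, seqAppend_left h₂]
    exact hv.2 p h₁ q h₂
  · rw [seqAppend_left h₁, seqAppend_right h₂, hadj _ h₁ _ (by omega)]
    omega
  · rw [seqAppend_right h₁, seqAppend_left h₂, G.adj_comm, hadj _ h₂ _ (by omega)]
    omega
  · rw [seqAppend_right h₁, seqAppend_right h₂, hw.2 _ (by omega) _ (by omega)]
    omega

theorem cycleGraph_adj_iff (n : ℕ) (i j : Fin (n + 2)) (hn : 1 ≤ n) :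
    (SimpleGraph.cycleGraph (n + 2)).Adj i j ↔
      i.val + 1 = j.val ∨ j.val + 1 = i.val ∨ (i.val = 0 ∧ j.val = n + 1) ∨
        (j.val = 0 ∧ i.val = n + 1) := by
  have key : ∀ x y : Fin (n + 2), (x - y).val = 1 ↔
      y.val + 1 = x.val ∨ (x.val = 0 ∧ y.val = n + 1) := by
    intro x y
    have hx := x.isLt
    have hy := y.isLt
    rw [Fin.val_sub]
    rcases le_or_gt y.val x.val with h | h
    · have : n + 2 - y.val + x.val = (x.val - y.val) + (n + 2) := by omega
      rw [this, Nat.add_mod_right, Nat.mod_eq_of_lt (by omega)]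
      omega
    · rw [Nat.mod_eq_of_lt (by omega)]
      omega
  rw [SimpleGraph.cycleGraph_adj', key, key]
  tauto

/-- Closing an induced path with a vertex adjacent to its two ends gives an induced cycle. -/
theorem IsPathSeq.exists_cycle {G : SimpleGraph V} {v : ℕ → V} {n : ℕ} (hv : IsPathSeq G v n)
    (hn : 1 ≤ n) (y : V) (hne : ∀ p ≤ n, v p ≠ y)
    (hadj : ∀ p ≤ n, G.Adj (v p) y ↔ p = 0 ∨ p = n) :
    ∃ H : InducedCycle G, H.length = n + 2 ∧ ∀ x ∈ H.verts, x = y ∨ ∃ p ≤ n, x = v p := by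
  have hlast : ∀ i : Fin (n + 2), i.val ≤ n ∨ i.val = n + 1 := fun i => by omega
  have hl : ∀ i : Fin (n + 2), i.val ≤ n → (if i.val ≤ n then v i.val else y) = v i.val :=
    fun i h => if_pos h
  have hr : ∀ i : Fin (n + 2), i.val = n + 1 → (if i.val ≤ n then v i.val else y) = y :=
    fun i h => if_neg (by omega)
  refine ⟨⟨n + 2, by omega, ⟨⟨fun i => if i.val ≤ n then v i.val else y, ?_⟩, ?_⟩⟩, rfl, ?_⟩
  · intro i j hij
    simp only at hij
    apply Fin.ext
    rcases hlast i with hi | hi <;> rcases hlast j with hj | hj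
    · rw [hl i hi, hl j hj] at hij
      exact hv.1 _ hi _ hj hij
    · rw [hl i hi, hr j hj] at hij
      exact absurd hij (hne _ hi)
    · rw [hr i hi, hl j hj] at hij
      exact absurd hij.symm (hne _ hj)
    · omega
  · intro i j
    change G.Adj (if i.val ≤ n then v i.val else y) (if j.val ≤ n then v j.val else y) ↔ _
    rw [cycleGraph_adj_iff n i j hn]
    rcases hlast i with hi | hi <;> rcases hlast j with hj | hj
    · rw [hl i hi, hl j hj, hv.2 _ hi _ hj]
      omega
    · rw [hl i hi, hr j hj, hadj _ hi]
      omega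
    · rw [hr i hi, hl j hj, G.adj_comm, hadj _ hj]
      omega
    · rw [hr i hi, hr j hj]
      simp only [SimpleGraph.irrefl, false_iff]
      omega
  · rintro x ⟨i, rfl⟩
    rcases hlast i with hi | hi
    · exact Or.inr ⟨i.val, hi, hl i hi⟩
    · exact Or.inl (hr i hi)

/-- Concatenating induced paths `P 0, …, P k` along vertices `y 1, …, y k`, where `y r` is
adjacent only to the last vertex of `P (r - 1)` and to the first vertex of `P r`. -/
theorem exists_pathSeq_of_chain {G : SimpleGraph V} (k : ℕ) (y : ℕ → V) (P : ℕ → ℕ → V)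
    (l : ℕ → ℕ) (hP : ∀ i ≤ k, IsPathSeq G (P i) (l i))
    (hPP : ∀ i ≤ k, ∀ j ≤ k, i ≠ j → ∀ p ≤ l i, ∀ q ≤ l j,
      P i p ≠ P j q ∧ ¬ G.Adj (P i p) (P j q))
    (hyy : ∀ r s, 1 ≤ r → r ≤ k → 1 ≤ s → s ≤ k → r ≠ s → y r ≠ y s ∧ ¬ G.Adj (y r) (y s))
    (hyP : ∀ r, 1 ≤ r → r ≤ k → ∀ i ≤ k, ∀ p ≤ l i, P i p ≠ y r ∧
      (G.Adj (P i p) (y r) ↔ (i = r ∧ p = 0) ∨ (i + 1 = r ∧ p = l i))) :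
    ∃ (v : ℕ → V) (n : ℕ), IsPathSeq G v n ∧ l 0 + 2 * k ≤ n ∧
      ∀ p ≤ n, (∃ r, 1 ≤ r ∧ r ≤ k ∧ v p = y r ∧ p ≠ 0 ∧ p ≠ n) ∨
        (∃ i ≤ k, ∃ q ≤ l i, v p = P i q ∧ (p = 0 ↔ i = 0 ∧ q = 0) ∧
          (p = n ↔ i = k ∧ q = l k)) := by
  induction k with
  | zero =>
    refine ⟨P 0, l 0, hP 0 le_rfl, by omega, fun p hp => Or.inr ⟨0, le_rfl, p, hp, rfl, ?_, ?_⟩⟩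
    · simp
    · simp
  | succ k ih =>
    obtain ⟨v, n, hv, hn, hd⟩ := ih (fun i hi => hP i (by omega))
      (fun i hi j hj => hPP i (by omega) j (by omega))
      (fun r s h₁ h₂ h₃ h₄ => hyy r s h₁ (by omega) h₃ (by omega))
      (fun r h₁ h₂ i hi => hyP r h₁ (by omega) i (by omega))
    have h₁ : IsPathSeq G (seqAppend v n (fun _ => y (k + 1))) (n + 1 + 0) := by
      refine hv.append (isPathSeq_zero G _) (fun p hp q _ => ?_) (fun p hp q hq => ?_)
      · rcases hd p hp with ⟨r, hr₁, hr₂, e, _⟩ | ⟨i, hi, s, hs, e, _⟩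
        · rw [e]
          exact (hyy r (k + 1) hr₁ (by omega) (by omega) le_rfl (by omega)).1
        · rw [e]
          exact (hyP (k + 1) (by omega) le_rfl i (by omega) s hs).1
      · rcases hd p hp with ⟨r, hr₁, hr₂, e, _, hpn⟩ | ⟨i, hi, s, hs, e, _, hpn⟩
        · rw [e]
          have := (hyy r (k + 1) hr₁ (by omega) (by omega) le_rfl (by omega)).2
          tauto
        · rw [e, (hyP (k + 1) (by omega) le_rfl i (by omega) s hs).2, hpn]
          constructor
          · rintro (⟨h, _⟩ | ⟨h, h'⟩)
            · omega
            · obtain rfl : i = k := by omega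
              exact ⟨⟨rfl, h'⟩, by omega⟩
          · rintro ⟨⟨rfl, h⟩, _⟩
            exact Or.inr ⟨rfl, h⟩
    have hy : ∀ p, p ≤ n + 1 + 0 → p ≤ n ∨ p = n + 1 := fun p hp => by omega
    have hyn : seqAppend v n (fun _ => y (k + 1)) (n + 1) = y (k + 1) :=
      seqAppend_right (by omega)
    have h₂ := h₁.append (hP (k + 1) le_rfl)
      (fun p hp q hq => by
        rcases hy p hp with h | rfl
        · rw [seqAppend_left h]
          rcases hd p h with ⟨r, hr₁, hr₂, e, _⟩ | ⟨i, hi, s, hs, e, _⟩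
          · rw [e]
            exact (hyP r hr₁ (by omega) (k + 1) le_rfl q hq).1.symm
          · rw [e]
            exact (hPP i (by omega) (k + 1) le_rfl (by omega) s hs q hq).1
        · rw [hyn]
          exact (hyP (k + 1) (by omega) le_rfl (k + 1) le_rfl q hq).1.symm)
      (fun p hp q hq => by
        rcases hy p hp with h | rfl
        · rw [seqAppend_left h]
          refine iff_of_false ?_ (by omega)
          rcases hd p h with ⟨r, hr₁, hr₂, e, _⟩ | ⟨i, hi, s, hs, e, _⟩
          · rw [e, G.adj_comm, (hyP r hr₁ (by omega) (k + 1) le_rfl q hq).2]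
            omega
          · rw [e]
            exact (hPP i (by omega) (k + 1) le_rfl (by omega) s hs q hq).2
        · rw [hyn, G.adj_comm, (hyP (k + 1) (by omega) le_rfl (k + 1) le_rfl q hq).2]
          omega)
    refine ⟨_, _, h₂, by omega, fun p hp => ?_⟩
    rcases le_or_gt p (n + 1 + 0) with hp' | hp'
    · rw [seqAppend_left hp']
      rcases hy p hp' with h | rfl
      · rw [seqAppend_left h]
        rcases hd p h with ⟨r, hr₁, hr₂, e, hp0, _⟩ | ⟨i, hi, s, hs, e, hp0, _⟩
        · exact Or.inl ⟨r, hr₁, by omega, e, hp0, by omega⟩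
        · exact Or.inr ⟨i, by omega, s, hs, e, hp0, by omega⟩
      · exact Or.inl ⟨k + 1, by omega, le_rfl, hyn, by omega, by omega⟩
    · rw [seqAppend_right hp']
      exact Or.inr ⟨k + 1, le_rfl, _, by omega, rfl, by omega, by omega⟩

/-- Induced paths `P 0, …, P k` and vertices `y 0, …, y k`, linked in a cyclic fashion, form an
induced cycle. -/
theorem exists_cycle_of_chain {G : SimpleGraph V} (k : ℕ) (hk : 1 ≤ k) (y : ℕ → V)
    (P : ℕ → ℕ → V) (l : ℕ → ℕ) (hP : ∀ i ≤ k, IsPathSeq G (P i) (l i))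
    (hPP : ∀ i ≤ k, ∀ j ≤ k, i ≠ j → ∀ p ≤ l i, ∀ q ≤ l j,
      P i p ≠ P j q ∧ ¬ G.Adj (P i p) (P j q))
    (hyy : ∀ r ≤ k, ∀ s ≤ k, r ≠ s → y r ≠ y s ∧ ¬ G.Adj (y r) (y s))
    (hyP : ∀ r ≤ k, ∀ i ≤ k, ∀ p ≤ l i, P i p ≠ y r ∧
      (G.Adj (P i p) (y r) ↔ (i = r ∧ p = 0) ∨ (r = (if i = k then 0 else i + 1) ∧ p = l i))) :
    ∃ H : InducedCycle G, l 0 + 2 * k + 2 ≤ H.length ∧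
      ∀ x ∈ H.verts, (∃ r ≤ k, x = y r) ∨ ∃ i ≤ k, ∃ p ≤ l i, x = P i p := by
  -- Cutting the cycle at `y 0` leaves a chain from the first vertex of `P 0` to the last vertex of
  -- `P k`; these ends are the only vertices of the chain seen by `y 0`.
  obtain ⟨v, n, hv, hn, hd⟩ := exists_pathSeq_of_chain k y P l hP hPP
    (fun r s _ hr _ hs => hyy r hr s hs) (fun r h₁ hr i hi p hp => by
      refine ⟨(hyP r hr i hi p hp).1, ?_⟩
      rw [(hyP r hr i hi p hp).2]
      split_ifs <;> omega)
  obtain ⟨H, hH, hH'⟩ := hv.exists_cycle (by omega) (y 0)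
    (fun p hp => by
      rcases hd p hp with ⟨r, hr₁, hr₂, e, _⟩ | ⟨i, hi, s, hs, e, _⟩
      · rw [e]
        exact (hyy r hr₂ 0 (by omega) (by omega)).1
      · rw [e]
        exact (hyP 0 (by omega) i hi s hs).1)
    (fun p hp => by
      rcases hd p hp with ⟨r, hr₁, hr₂, e, h0, h1⟩ | ⟨i, hi, s, hs, e, h0, h1⟩
      · rw [e]
        exact iff_of_false (hyy r hr₂ 0 (by omega) (by omega)).2 (by omega)
      · rw [e, (hyP 0 (by omega) i hi s hs).2, h0, h1]
        constructor
        · rintro (h | ⟨h, h'⟩)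
          · exact Or.inl h
          · split_ifs at h with h₂
            · exact Or.inr ⟨h₂, h₂ ▸ h'⟩
        · rintro (h | ⟨rfl, h'⟩)
          · exact Or.inl h
          · exact Or.inr ⟨by simp, h'⟩)
  refine ⟨H, by omega, fun x hx => ?_⟩
  rcases hH' x hx with rfl | ⟨p, hp, rfl⟩
  · exact Or.inl ⟨0, by omega, rfl⟩
  · rcases hd p hp with ⟨r, _, hr, e, _⟩ | ⟨i, hi, s, hs, e, _⟩
    · exact Or.inl ⟨r, hr, e⟩
    · exact Or.inr ⟨i, hi, s, hs, e⟩

/-! ### Families of separated long cycles -/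

/-- `G[Z]` contains `c` pairwise disjoint and anticomplete cycles of length at least `o + 2`. -/
def HasCycles (G : SimpleGraph V) (o c : ℕ) (Z : Set V) : Prop :=
  ∃ H : Fin c → InducedCycle G, (∀ i, o + 2 ≤ (H i).length ∧ (H i).verts ⊆ Z) ∧
    ∀ i j, i ≠ j → Disjoint (H i).verts (H j).verts ∧ Anticomplete G (H i).verts (H j).verts

theorem HasCycles.not_isPerforated {G : SimpleGraph V} {o c : ℕ} {Z : Set V}
    (h : HasCycles G o c Z) : ¬ IsPerforated G c o :=
  fun hp => hp (h.imp fun _ hH => ⟨fun i => (hH.1 i).1, hH.2⟩)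

theorem HasCycles.zero (G : SimpleGraph V) (o : ℕ) (Z : Set V) : HasCycles G o 0 Z :=
  ⟨fun i => i.elim0, fun i => i.elim0, fun i => i.elim0⟩

theorem HasCycles.one {G : SimpleGraph V} {o : ℕ} {Z : Set V} (H : InducedCycle G)
    (h : o + 2 ≤ H.length) (hZ : H.verts ⊆ Z) : HasCycles G o 1 Z :=
  ⟨fun _ => H, fun _ => ⟨h, hZ⟩, fun i j hij => absurd (Subsingleton.elim i j) hij⟩

theorem HasCycles.succ {G : SimpleGraph V} {o c : ℕ} {Z Z' : Set V} (h : HasCycles G o c Z)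
    (h' : HasCycles G o 1 Z') (hd : Disjoint Z Z') (ha : Anticomplete G Z Z') :
    HasCycles G o (c + 1) (Z ∪ Z') := by
  obtain ⟨H, hH, hH'⟩ := h
  obtain ⟨K, hK, -⟩ := h'
  have hd' : ∀ i, Disjoint (H i).verts (K 0).verts ∧ Anticomplete G (H i).verts (K 0).verts :=
    fun i => ⟨hd.mono (hH i).2 (hK 0).2, fun x hx y hy => ha x ((hH i).2 hx) y ((hK 0).2 hy)⟩
  refine ⟨Fin.snoc (α := fun _ => InducedCycle G) H (K 0), fun i => ?_, fun i j => ?_⟩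
  · refine Fin.lastCases ?_ (fun i => ?_) i
    · rw [Fin.snoc_last]
      exact ⟨(hK 0).1, (hK 0).2.trans Set.subset_union_right⟩
    · rw [Fin.snoc_castSucc]
      exact ⟨(hH i).1, (hH i).2.trans Set.subset_union_left⟩
  · refine Fin.lastCases ?_ (fun i => ?_) i <;> refine Fin.lastCases ?_ (fun j => ?_) j <;>
      intro hij
    · exact absurd rfl hij
    · rw [Fin.snoc_last, Fin.snoc_castSucc]
      exact ⟨(hd' j).1.symm, fun x hx y hy h => (hd' j).2 y hy x hx h.symm⟩
    · rw [Fin.snoc_last, Fin.snoc_castSucc]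
      exact hd' i
    · rw [Fin.snoc_castSucc, Fin.snoc_castSucc]
      exact hH' i j (fun h => hij (h ▸ rfl))

theorem HasCycles.of_family {G : SimpleGraph V} {o : ℕ} (Z : ℕ → Set V) (c : ℕ)
    (h : ∀ i < c, HasCycles G o 1 (Z i))
    (hs : ∀ i < c, ∀ j < c, i ≠ j → Disjoint (Z i) (Z j) ∧ Anticomplete G (Z i) (Z j)) :
    HasCycles G o c Set.univ := by
  choose! H hH _ using h
  refine ⟨fun i => H i i.isLt 0, fun i => ⟨(hH i i.isLt 0).1, Set.subset_univ _⟩,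
    fun i j hij => ?_⟩
  have := hs i i.isLt j j.isLt (fun h => hij (Fin.ext h))
  exact ⟨this.1.mono (hH i i.isLt 0).2 (hH j j.isLt 0).2,
    fun x hx y hy => this.2 x ((hH i i.isLt 0).2 hx) y ((hH j j.isLt 0).2 hy)⟩

/-! ### Path systems, links and holes -/

/-- A plain constellation with its paths parametrized by an initial segment of `ℕ`, and without
the requirement that vertices of the stable set have neighbors in the paths. -/
structure PathSystem where
  V : Type u
  G : SimpleGraph V
  S : Set V
  ι : Type
  len : ι → ℕ
  pt : ι → ℕ → V
  stable : ∀ x ∈ S, ∀ y ∈ S, ¬ G.Adj x y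
  isPathSeq : ∀ i, IsPathSeq G (pt i) (len i)
  sep : ∀ i j, i ≠ j → ∀ p ≤ len i, ∀ q ≤ len j, pt i p ≠ pt j q ∧ ¬ G.Adj (pt i p) (pt j q)
  notMem : ∀ i, ∀ p ≤ len i, pt i p ∉ S

namespace PathSystem

variable (W : PathSystem.{u})

/-- The vertex `x` has a neighbor on the `j`th path between positions `a` and `b`. -/
def Hit (j : W.ι) (a b : ℕ) (x : W.V) : Prop :=
  ∃ p, a ≤ p ∧ p ≤ b ∧ W.G.Adj x (W.pt j p)

/-- On the segment `[a, b]` of the `j`th path, `y` is adjacent to `a` only and `z` is adjacent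
to `b` only. -/
def Link (j : W.ι) (a b : ℕ) (y z : W.V) : Prop :=
  a ≤ b ∧ ∀ p, a ≤ p → p ≤ b → (W.G.Adj y (W.pt j p) ↔ p = a) ∧ (W.G.Adj z (W.pt j p) ↔ p = b)

/-- The segment `[a, b]` of the `j`th path is a link between `y` and `z`, in some direction. -/
def Linked (j : W.ι) (a b : ℕ) (y z : W.V) : Prop :=
  W.Link j a b y z ∨ W.Link j a b z y

/-- On the segment `[a, b]` of the `j`th path, of length at least `o`, the vertex `y` is adjacent
to the ends only. -/
def Hole (o : ℕ) (j : W.ι) (a b : ℕ) (y : W.V) : Prop :=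
  a < b ∧ o ≤ b - a ∧ ∀ p, a ≤ p → p ≤ b → (W.G.Adj y (W.pt j p) ↔ p = a ∨ p = b)

/-- The set of vertices at given positions. -/
def cells (T : Set (W.ι × ℕ)) : Set W.V := {v | ∃ q ∈ T, v = W.pt q.1 q.2}

variable {W}

theorem Hit.mono {j : W.ι} {a b a' b' : ℕ} {x : W.V} (h : W.Hit j a b x) (ha : a' ≤ a)
    (hb : b ≤ b') : W.Hit j a' b' x := by
  obtain ⟨p, h₁, h₂, h₃⟩ := h
  exact ⟨p, by omega, by omega, h₃⟩

theorem Linked.symm {j : W.ι} {a b : ℕ} {y z : W.V} (h : W.Linked j a b y z) :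
    W.Linked j a b z y :=
  Or.symm h

theorem Linked.le {j : W.ι} {a b : ℕ} {y z : W.V} (h : W.Linked j a b y z) : a ≤ b :=
  h.elim (fun h => h.1) (fun h => h.1)

/-- Since `W.S` is stable and distinct paths are anticomplete, the only possible edges join a
stable-set vertex of one side to a path vertex of the other. -/
theorem separated_of_disjoint {E E' : Set W.V} {T T' : Set (W.ι × ℕ)} (hE : E ⊆ W.S)
    (hE' : E' ⊆ W.S) (hT : ∀ q ∈ T, q.2 ≤ W.len q.1) (hT' : ∀ q ∈ T', q.2 ≤ W.len q.1)
    (hd : ∀ x ∈ E, ∀ y ∈ E', x ≠ y) (hTT : ∀ q ∈ T, ∀ q' ∈ T', q.1 ≠ q'.1)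
    (hET : ∀ x ∈ E, ∀ q ∈ T', ¬ W.G.Adj x (W.pt q.1 q.2))
    (hTE : ∀ x ∈ E', ∀ q ∈ T, ¬ W.G.Adj x (W.pt q.1 q.2)) :
    Disjoint (E ∪ W.cells T) (E' ∪ W.cells T') ∧
      Anticomplete W.G (E ∪ W.cells T) (E' ∪ W.cells T') := by
  refine ⟨Set.disjoint_left.mpr ?_, ?_⟩
  · rintro v (hv | ⟨q, hq, rfl⟩) (hv' | ⟨q', hq', e⟩)
    · exact hd v hv v hv' rfl
    · exact W.notMem _ _ (hT' q' hq') (e ▸ hE hv)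
    · exact W.notMem _ _ (hT q hq) (hE' hv')
    · exact (W.sep _ _ (hTT q hq q' hq') _ (hT q hq) _ (hT' q' hq')).1 e
  · rintro v (hv | ⟨q, hq, rfl⟩) v' (hv' | ⟨q', hq', rfl⟩)
    · exact W.stable v (hE hv) v' (hE' hv')
    · exact hET v hv q' hq'
    · exact fun h => hTE v' hv' q hq h.symm
    · exact (W.sep _ _ (hTT q hq q' hq') _ (hT q hq) _ (hT' q' hq')).2

theorem isPathSeq_segment {j : W.ι} {a b : ℕ} (hab : a ≤ b) (hb : b ≤ W.len j) :
    IsPathSeq W.G (fun p => W.pt j (a + p)) (b - a) :=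
  ((W.isPathSeq j).shift hb).resolve_right (by omega)

/-- Orients the link from `y` to `z`, reversing the segment if necessary, so that links can be
traversed consistently around a cycle. -/
theorem Linked.exists_pathSeq {j : W.ι} {a b : ℕ} {y z : W.V} (h : W.Linked j a b y z)
    (hb : b ≤ W.len j) : ∃ P : ℕ → W.V, IsPathSeq W.G P (b - a) ∧ ∀ p ≤ b - a,
      ∃ q, a ≤ q ∧ q ≤ b ∧ P p = W.pt j q ∧ (W.G.Adj y (W.pt j q) ↔ p = 0) ∧
        (W.G.Adj z (W.pt j q) ↔ p = b - a) := by
  have hab := h.le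
  rcases h with h | h
  · refine ⟨_, isPathSeq_segment hab hb, fun p hp => ⟨a + p, by omega, by omega, rfl, ?_, ?_⟩⟩
    · rw [(h.2 (a + p) (by omega) (by omega)).1]
      omega
    · rw [(h.2 (a + p) (by omega) (by omega)).2]
      omega
  · refine ⟨_, (isPathSeq_segment hab hb).reverse,
      fun p hp => ⟨a + (b - a - p), by omega, by omega, rfl, ?_, ?_⟩⟩
    · rw [(h.2 (a + (b - a - p)) (by omega) (by omega)).2]
      omega
    · rw [(h.2 (a + (b - a - p)) (by omega) (by omega)).1]
      omega

/-- A hole of `y` closes up to a long cycle. -/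
theorem Hole.hasCycles {o : ℕ} {j : W.ι} {a b : ℕ} {y : W.V} (h : W.Hole o j a b y)
    (hb : b ≤ W.len j) (hy : y ∈ W.S) :
    HasCycles W.G o 1 ({y} ∪ W.cells {q | q.1 = j ∧ a ≤ q.2 ∧ q.2 ≤ b}) := by
  obtain ⟨hab, ho, hadj⟩ := h
  obtain ⟨H, hH, hH'⟩ := (isPathSeq_segment hab.le hb).exists_cycle (by omega) y
    (fun p hp e => W.notMem j (a + p) (by omega) (e ▸ hy))
    (fun p hp => by
      rw [W.G.adj_comm, hadj (a + p) (by omega) (by omega)]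
      omega)
  refine HasCycles.one H (by omega) fun x hx => ?_
  rcases hH' x hx with rfl | ⟨p, hp, rfl⟩
  · exact Or.inl rfl
  · exact Or.inr ⟨(j, a + p), ⟨rfl, by simp, by simp only; omega⟩, rfl⟩

/-- Links arranged in a cyclic fashion, on different paths, close up to a long cycle. -/
theorem hasCycles_of_links {o k : ℕ} (hk : 1 ≤ k) (ρ : ℕ → W.ι) (e : ℕ → W.V) (a b : ℕ → ℕ)
    (hρ : ∀ i ≤ k, ∀ j ≤ k, i ≠ j → ρ i ≠ ρ j) (he : ∀ i ≤ k, ∀ j ≤ k, i ≠ j → e i ≠ e j)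
    (hS : ∀ i ≤ k, e i ∈ W.S) (hb : ∀ i ≤ k, b i ≤ W.len (ρ i))
    (hl : ∀ i ≤ k, W.Linked (ρ i) (a i) (b i) (e i) (e (if i = k then 0 else i + 1)))
    (hm : ∀ i ≤ k, ∀ r ≤ k, r ≠ i → r ≠ (if i = k then 0 else i + 1) →
      ¬ W.Hit (ρ i) (a i) (b i) (e r))
    (ho : o ≤ b 0 - a 0 + 2 * k) :
    HasCycles W.G o 1 ({x | ∃ i ≤ k, x = e i} ∪
      W.cells {q | ∃ i ≤ k, q.1 = ρ i ∧ a i ≤ q.2 ∧ q.2 ≤ b i}) := by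
  have hP := fun i (hi : i ≤ k) => (hl i hi).exists_pathSeq (hb i hi)
  have : Nonempty W.V := ⟨e 0⟩
  choose! P hP hPq using hP
  choose! s hs₁ hs₂ hs₃ hs₄ hs₅ using hPq
  obtain ⟨H, hH, hH'⟩ := exists_cycle_of_chain k hk e P (fun i => b i - a i) hP
    (fun i hi j hj hij p hp q hq => by
      rw [hs₃ i hi p hp, hs₃ j hj q hq]
      exact W.sep _ _ (hρ i hi j hj hij) _ ((hs₂ i hi p hp).trans (hb i hi)) _
        ((hs₂ j hj q hq).trans (hb j hj)))
    (fun r hr t ht hrt => ⟨he r hr t ht hrt, W.stable _ (hS r hr) _ (hS t ht)⟩)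
    (fun r hr i hi p hp => by
      rw [hs₃ i hi p hp]
      refine ⟨fun h => W.notMem _ _ ((hs₂ i hi p hp).trans (hb i hi)) (h ▸ hS r hr), ?_⟩
      rw [W.G.adj_comm]
      by_cases h₁ : r = i
      · subst h₁
        rw [hs₄ r hi p hp]
        -- As `k ≥ 1`, the cyclic successor of `i` differs from `i`.
        split_ifs <;> omega
      · by_cases h₂ : r = (if i = k then 0 else i + 1)
        · have := hs₅ i hi p hp
          rw [← h₂] at this
          rw [this]
          omega
        · refine iff_of_false (fun h => hm i hi r hr h₁ h₂ ⟨_, hs₁ i hi p hp, hs₂ i hi p hp, h⟩) ?_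
          omega)
  refine HasCycles.one H (by omega) fun x hx => ?_
  rcases hH' x hx with ⟨r, hr, rfl⟩ | ⟨i, hi, p, hp, rfl⟩
  · exact Or.inl ⟨r, hr, rfl⟩
  · exact Or.inr ⟨(ρ i, s i p), ⟨i, hi, rfl, hs₁ i hi p hp, hs₂ i hi p hp⟩, hs₃ i hi p hp⟩

/-- A shortest segment hit by all of `X` is a link between two vertices of `X`. -/
theorem exists_link_of_hit {X : Finset W.V} {j : W.ι} {lo hi : ℕ} (hX : 2 ≤ X.card)
    (hit : ∀ x ∈ X, W.Hit j lo hi x)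
    (ample : ∀ p, lo ≤ p → p ≤ hi → ∀ x ∈ X, ∀ y ∈ X, W.G.Adj x (W.pt j p) →
      W.G.Adj y (W.pt j p) → x = y) :
    ∃ a b, lo ≤ a ∧ b ≤ hi ∧ X.card ≤ b - a + 1 ∧ ∃ x ∈ X, ∃ y ∈ X, x ≠ y ∧ W.Link j a b x y := by
  classical
  have hne : ∃ n a, lo ≤ a ∧ a + n ≤ hi ∧ ∀ x ∈ X, W.Hit j a (a + n) x := by
    obtain ⟨x, hx⟩ : X.Nonempty := Finset.card_pos.mp (by omega)
    obtain ⟨p, h₁, h₂, _⟩ := hit x hx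
    refine ⟨hi - lo, lo, le_rfl, by omega, fun x hx => (hit x hx).mono le_rfl (by omega)⟩
  -- `Nat.find` selects the least length `n` of a segment hit by all of `X`.
  obtain ⟨a, ha, hb, hall⟩ := Nat.find_spec hne
  have hmin := fun m (hm : m < Nat.find hne) => Nat.find_min hne hm
  set n := Nat.find hne
  -- By ampleness, chosen neighbors of distinct vertices are distinct.
  have hcard : X.card ≤ n + 1 := by
    choose! p hp₁ hp₂ hp₃ using hall
    have : X.card ≤ (Finset.Icc a (a + n)).card := by
      refine Finset.card_le_card_of_injOn p (fun x hx => ?_) (fun x hx y hy h => ?_)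
      · exact Finset.mem_coe.mpr (Finset.mem_Icc.mpr ⟨hp₁ x hx, hp₂ x hx⟩)
      · exact ample (p x) (by have := hp₁ x hx; omega) (by have := hp₂ x hx; omega) x hx y hy
          (hp₃ x hx) (h ▸ hp₃ y hy)
    rw [Nat.card_Icc] at this
    omega
  -- By minimality, dropping the first position loses some vertex of `X`, whose only neighbor on the
  -- segment is therefore that position; the same applies to the last position.
  have hl : ∃ x ∈ X, ¬ W.Hit j (a + 1) (a + n) x := by
    by_contra! h
    refine hmin (n - 1) (by omega) ⟨a + 1, by omega, by omega, fun x hx => ?_⟩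
    exact (h x hx).mono le_rfl (by omega)
  have hr : ∃ x ∈ X, ¬ W.Hit j a (a + n - 1) x := by
    by_contra! h
    refine hmin (n - 1) (by omega) ⟨a, by omega, by omega, fun x hx => ?_⟩
    exact (h x hx).mono le_rfl (by omega)
  obtain ⟨x, hx, hx'⟩ := hl
  obtain ⟨y, hy, hy'⟩ := hr
  have hxa : ∀ p, a ≤ p → p ≤ a + n → W.G.Adj x (W.pt j p) → p = a := fun p h₁ h₂ h =>
    by_contra fun hne => hx' ⟨p, by omega, h₂, h⟩
  have hyb : ∀ p, a ≤ p → p ≤ a + n → W.G.Adj y (W.pt j p) → p = a + n := fun p h₁ h₂ h =>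
    by_contra fun hne => hy' ⟨p, h₁, by omega, h⟩
  obtain ⟨p, hp₁, hp₂, hp₃⟩ := hall x hx
  obtain rfl := hxa p hp₁ hp₂ hp₃
  obtain ⟨q, hq₁, hq₂, hq₃⟩ := hall y hy
  obtain rfl := hyb q hq₁ hq₂ hq₃
  refine ⟨p, p + n, ha, hb, by omega, x, hx, y, hy, ?_, by omega, fun r h₁ h₂ => ⟨?_, ?_⟩⟩
  · rintro rfl
    have := hxa _ hq₁ hq₂ hq₃
    omega
  · exact ⟨hxa r h₁ h₂, fun h => h ▸ hp₃⟩
  · exact ⟨hyb r h₁ h₂, fun h => h ▸ hq₃⟩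

end PathSystem

/-! ### Sparsely hit links and holes in a perforated graph -/

/-- The indices `i * K + r` cut `c * K` vertices, and as many paths, into `c` blocks of size `K`,
one for each cycle. -/
theorem mul_add_lt_mul {c K i r : ℕ} (hi : i < c) (hr : r < K) : i * K + r < c * K :=
  calc i * K + r < i * K + K := by omega
    _ = (i + 1) * K := by ring
    _ ≤ c * K := Nat.mul_le_mul_right K hi

theorem eq_of_mul_add_eq {K i i' r r' : ℕ} (hr : r < K) (hr' : r' < K)
    (h : i * K + r = i' * K + r') : i = i' ∧ r = r' := by
  have hK : 0 < K := by omega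
  have h₁ : (r + K * i) / K = i := by
    rw [Nat.add_mul_div_left _ _ hK, Nat.div_eq_of_lt hr, zero_add]
  have h₂ : (r' + K * i') / K = i' := by
    rw [Nat.add_mul_div_left _ _ hK, Nat.div_eq_of_lt hr', zero_add]
  have h₃ : r + K * i = r' + K * i' := by
    rw [mul_comm K, mul_comm K]
    omega
  have h₄ : i = i' := by rw [← h₁, h₃, h₂]
  subst h₄
  exact ⟨rfl, by omega⟩

theorem IsPerforated.pos {V : Type u} {G : SimpleGraph V} {c o : ℕ} (h : IsPerforated G c o) :
    0 < c := by
  rcases Nat.eq_zero_or_pos c with rfl | hc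
  · exact absurd h (HasCycles.zero G o Set.univ).not_isPerforated
  · exact hc

namespace PathSystem

/-- A large clique of mutually linked vertices, whose links are pairwise free, gives many
separated long cycles. -/
theorem not_isPerforated_of_linked {W : PathSystem.{u}} {c o : ℕ} {Y : Finset W.V}
    {J : Finset W.ι} (hYS : (Y : Set W.V) ⊆ W.S) (hY : c * (o + 2) ≤ Y.card)
    (hJ : c * (o + 2) ≤ J.card) (a b : W.ι → W.V → W.V → ℕ)
    (hl : ∀ j ∈ J, ∀ y ∈ Y, ∀ z ∈ Y, y ≠ z →
      b j y z ≤ W.len j ∧ W.Linked j (a j y z) (b j y z) y z)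
    (hm : ∀ j ∈ J, ∀ y ∈ Y, ∀ z ∈ Y, ∀ w ∈ Y, y ≠ z → w ≠ y → w ≠ z →
      ¬ W.Hit j (a j y z) (b j y z) w) :
    ¬ IsPerforated W.G c o := by
  intro hperf
  have hc := hperf.pos
  -- Each cycle uses its own `o + 2` vertices and `o + 2` paths. This number alone makes it long
  -- enough, even if all its links have length zero.
  obtain ⟨e, heY, he⟩ := exists_seq_of_le_card Y _ (by positivity) hY
  obtain ⟨ρ, hρJ, hρ⟩ := exists_seq_of_le_card J _ (by positivity) hJ
  have hlt : ∀ i < c, ∀ r ≤ o + 1, i * (o + 2) + r < c * (o + 2) := fun i hi r hr =>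
    mul_add_lt_mul hi (by omega)
  have hne : ∀ i < c, ∀ r ≤ o + 1, ∀ i' < c, ∀ r' ≤ o + 1, (i ≠ i' ∨ r ≠ r') →
      e (i * (o + 2) + r) ≠ e (i' * (o + 2) + r') ∧
        ρ (i * (o + 2) + r) ≠ ρ (i' * (o + 2) + r') := by
    intro i hi r hr i' hi' r' hr' h
    have : i * (o + 2) + r ≠ i' * (o + 2) + r' := fun h' => by
      have := eq_of_mul_add_eq (by omega) (by omega) h'
      omega
    exact ⟨fun h => this (he _ (hlt i hi r hr) _ (hlt i' hi' r' hr') h),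
      fun h => this (hρ _ (hlt i hi r hr) _ (hlt i' hi' r' hr') h)⟩
  have hE : ∀ i < c, ∀ r ≤ o + 1, e (i * (o + 2) + r) ∈ Y := fun i hi r hr =>
    heY _ (hlt i hi r hr)
  have hR : ∀ i < c, ∀ r ≤ o + 1, ρ (i * (o + 2) + r) ∈ J := fun i hi r hr =>
    hρJ _ (hlt i hi r hr)
  let nx : ℕ → ℕ := fun r => if r = o + 1 then 0 else r + 1
  have hnx : ∀ r ≤ o + 1, nx r ≤ o + 1 ∧ nx r ≠ r := by
    intro r hr
    simp only [nx]
    split_ifs <;> omega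
  let α : ℕ → ℕ → ℕ := fun i r => a (ρ (i * (o + 2) + r)) (e (i * (o + 2) + r))
    (e (i * (o + 2) + nx r))
  let β : ℕ → ℕ → ℕ := fun i r => b (ρ (i * (o + 2) + r)) (e (i * (o + 2) + r))
    (e (i * (o + 2) + nx r))
  have hL : ∀ i < c, ∀ r ≤ o + 1, β i r ≤ W.len (ρ (i * (o + 2) + r)) ∧
      W.Linked (ρ (i * (o + 2) + r)) (α i r) (β i r) (e (i * (o + 2) + r))
        (e (i * (o + 2) + nx r)) := fun i hi r hr =>
    hl _ (hR i hi r hr) _ (hE i hi r hr) _ (hE i hi _ (hnx r hr).1)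
      (hne i hi r hr i hi _ (hnx r hr).1 (Or.inr (hnx r hr).2.symm)).1
  have hM : ∀ i < c, ∀ r ≤ o + 1, ∀ i' < c, ∀ r' ≤ o + 1, (i' ≠ i ∨ r' ≠ r) →
      (i' ≠ i ∨ r' ≠ nx r) →
      ¬ W.Hit (ρ (i * (o + 2) + r)) (α i r) (β i r) (e (i' * (o + 2) + r')) :=
    fun i hi r hr i' hi' r' hr' h₁ h₂ =>
      hm _ (hR i hi r hr) _ (hE i hi r hr) _ (hE i hi _ (hnx r hr).1) _ (hE i' hi' r' hr')
        (hne i hi r hr i hi _ (hnx r hr).1 (Or.inr (hnx r hr).2.symm)).1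
        (hne i' hi' r' hr' i hi r hr h₁).1 (hne i' hi' r' hr' i hi _ (hnx r hr).1 h₂).1
  refine (HasCycles.of_family (G := W.G) (o := o)
    (fun i => {x | ∃ r ≤ o + 1, x = e (i * (o + 2) + r)} ∪
      W.cells {q | ∃ r ≤ o + 1, q.1 = ρ (i * (o + 2) + r) ∧ α i r ≤ q.2 ∧ q.2 ≤ β i r}) c
    (fun i hi => ?_) (fun i hi i' hi' hii' => ?_)).not_isPerforated hperf
  · exact hasCycles_of_links (by omega) (fun r => ρ (i * (o + 2) + r))
      (fun r => e (i * (o + 2) + r)) (α i) (β i)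
      (fun r hr r' hr' h => (hne i hi r hr i hi r' hr' (Or.inr h)).2)
      (fun r hr r' hr' h => (hne i hi r hr i hi r' hr' (Or.inr h)).1)
      (fun r hr => hYS (hE i hi r hr)) (fun r hr => (hL i hi r hr).1)
      (fun r hr => (hL i hi r hr).2)
      (fun r hr r' hr' h₁ h₂ => hM i hi r hr i hi r' hr' (Or.inr h₁) (Or.inr h₂)) (by omega)
  · refine separated_of_disjoint ?_ ?_ ?_ ?_ ?_ ?_ ?_ ?_
    · rintro x ⟨r, hr, rfl⟩
      exact hYS (hE i hi r hr)
    · rintro x ⟨r, hr, rfl⟩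
      exact hYS (hE i' hi' r hr)
    · rintro ⟨j, p⟩ ⟨r, hr, rfl, _, h⟩
      exact h.trans (hL i hi r hr).1
    · rintro ⟨j, p⟩ ⟨r, hr, rfl, _, h⟩
      exact h.trans (hL i' hi' r hr).1
    · rintro x ⟨r, hr, rfl⟩ y ⟨r', hr', rfl⟩
      exact (hne i hi r hr i' hi' r' hr' (Or.inl hii')).1
    · rintro ⟨j, p⟩ ⟨r, hr, rfl, _, _⟩ ⟨j', p'⟩ ⟨r', hr', rfl, _, _⟩
      exact (hne i hi r hr i' hi' r' hr' (Or.inl hii')).2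
    · rintro x ⟨r, hr, rfl⟩ ⟨j, p⟩ ⟨r', hr', rfl, h₁, h₂⟩ h
      exact hM i' hi' r' hr' i hi r hr (Or.inl hii') (Or.inl hii') ⟨p, h₁, h₂, h⟩
    · rintro x ⟨r, hr, rfl⟩ ⟨j, p⟩ ⟨r', hr', rfl, h₁, h₂⟩ h
      exact hM i hi r' hr' i' hi' r hr (Or.inl hii'.symm) (Or.inl hii'.symm) ⟨p, h₁, h₂, h⟩

open Classical in
/-- If the pairs in relation `H j` have links on the `j`th path hit by few vertices, then there is
a large set of vertices that is stable for `H j`, for many `j`. -/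
theorem exists_stable_of_linked (c o m n l : ℕ) : ∃ N L : ℕ, ∀ W : PathSystem.{u},
    IsPerforated W.G c o → ∀ (X : Finset W.V) (J : Finset W.ι) (H : W.ι → W.V → W.V → Prop),
    (X : Set W.V) ⊆ W.S → (∀ j y z, H j y z → H j z y) →
    (∀ j ∈ J, ∀ y ∈ X, ∀ z ∈ X, y ≠ z → H j y z → ∃ a b, b ≤ W.len j ∧ W.Linked j a b y z ∧
      ∀ Y ⊆ X, (∀ w ∈ Y, W.Hit j a b w) → Y.card ≤ m) →
    N ≤ X.card → L ≤ J.card →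
    ∃ X' ⊆ X, n ≤ X'.card ∧ ∃ J' ⊆ J, l ≤ J'.card ∧
      ∀ j ∈ J', ∀ y ∈ X', ∀ z ∈ X', y ≠ z → ¬ H j y z := by
  obtain ⟨R, hR⟩ := exists_clique_or_stable (c * (o + 2)) n
  obtain ⟨N, hN⟩ := exists_free_set_pairs (m + m) R
  -- The powers of two count the possible hitting patterns (sets of triples) and relations (sets of
  -- pairs) on `N` vertices; `X` is truncated to exactly `N` elements to keep this bounded.
  refine ⟨N, 2 ^ (N * (N * N)) * 2 ^ (N * N) * (l + c * (o + 2)),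
    fun W hperf X₀ J H hX₀S hsymm hH₀ hX₀ hJ => ?_⟩
  obtain ⟨X, hXX₀, hXc⟩ := Finset.exists_subset_card_eq hX₀
  have hXS : (X : Set W.V) ⊆ W.S := (Finset.coe_subset.mpr hXX₀).trans hX₀S
  have hH : ∀ j ∈ J, ∀ y ∈ X, ∀ z ∈ X, y ≠ z → H j y z → ∃ a b, b ≤ W.len j ∧
      W.Linked j a b y z ∧ ∀ Y ⊆ X, (∀ w ∈ Y, W.Hit j a b w) → Y.card ≤ m := by
    intro j hj y hy z hz hyz h
    obtain ⟨a, b, h₁, h₂, h₃⟩ := hH₀ j hj y (hXX₀ hy) z (hXX₀ hz) hyz h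
    exact ⟨a, b, h₁, h₂, fun Y hY => h₃ Y (hY.trans hXX₀)⟩
  choose! a b hb hl hm using hH
  -- On the paths retained, the relation and the hitting pattern of the chosen links agree, so what
  -- is proved for one path `j₀` holds for all.
  obtain ⟨J', hJ'J, ⟨T, B⟩, -, hJ', hφ⟩ := exists_large_fiber J
    ((X ×ˢ X ×ˢ X).powerset ×ˢ (X ×ˢ X).powerset)
    (fun j => ((X ×ˢ X ×ˢ X).filter (fun q => W.Hit j (a j q.1 q.2.1) (b j q.1 q.2.1) q.2.2),
      (X ×ˢ X).filter (fun q => H j q.1 q.2))) (l + c * (o + 2))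
    (fun j _ => by
      rw [Finset.mem_product]
      exact ⟨Finset.mem_powerset.mpr (Finset.filter_subset _ _),
        Finset.mem_powerset.mpr (Finset.filter_subset _ _)⟩)
    ⟨(∅, ∅), by simp⟩
    (by simpa only [Finset.card_product, Finset.card_powerset, hXc] using hJ)
  have hT : ∀ j ∈ J', ∀ y ∈ X, ∀ z ∈ X, ∀ w ∈ X,
      (y, z, w) ∈ T ↔ W.Hit j (a j y z) (b j y z) w := by
    intro j hj y hy z hz w hw
    rw [← (Prod.mk.inj (hφ j hj)).1]
    simp [hy, hz, hw]
  have hB : ∀ j ∈ J', ∀ y ∈ X, ∀ z ∈ X, (y, z) ∈ B ↔ H j y z := by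
    intro j hj y hy z hz
    rw [← (Prod.mk.inj (hφ j hj)).2]
    simp [hy, hz]
  have hc := hperf.pos
  have hMpos : 0 < c * (o + 2) := by positivity
  obtain ⟨j₀, hj₀⟩ : J'.Nonempty := Finset.card_pos.mp (by omega)
  let g : W.V → W.V → Finset W.V := fun y z => X.filter (fun w => (y, z) ∈ B ∧ (y, z, w) ∈ T)
  have hg : ∀ y ∈ X, ∀ z ∈ X, y ≠ z → (g y z).card ≤ m := by
    intro y hy z hz hyz
    by_cases h : (y, z) ∈ B
    · refine hm j₀ (hJ'J hj₀) y hy z hz hyz ((hB j₀ hj₀ y hy z hz).mp h) _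
        (Finset.filter_subset _ _) fun w hw => ?_
      have hw' := Finset.mem_filter.mp hw
      exact (hT j₀ hj₀ y hy z hz w hw'.1).mp hw'.2.2
    · simp [g, h]
  -- The chosen links depend on the order of the pair; symmetrizing the mapping costs the bound `m +
  -- m`.
  obtain ⟨X₁, hX₁X, hX₁, hfree⟩ := hN X (fun y z => g y z ∪ g z y)
    (fun y z => Finset.union_comm _ _)
    (fun y hy z hz hyz => (Finset.card_union_le _ _).trans
      (Nat.add_le_add (hg y hy z hz hyz) (hg z hz y hy hyz.symm))) hXc.ge
  rcases hR (H j₀) (hsymm j₀) X₁ hX₁ with ⟨Y, hY, hYc, hq⟩ | ⟨Y, hY, hYc, hq⟩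
  · exfalso
    have hYX := hY.trans hX₁X
    have hYH : ∀ j ∈ J', ∀ y ∈ Y, ∀ z ∈ Y, y ≠ z → H j y z := fun j hj y hy z hz hyz =>
      (hB j hj y (hYX hy) z (hYX hz)).mp ((hB j₀ hj₀ y (hYX hy) z (hYX hz)).mpr
        (hq y hy z hz hyz))
    refine not_isPerforated_of_linked ((Finset.coe_subset.mpr hYX).trans hXS) hYc
      ((Nat.le_add_left _ _).trans hJ') a b (fun j hj y hy z hz hyz => ?_)
      (fun j hj y hy z hz w hw hyz hwy hwz hit => ?_) hperf
    · have := hYH j hj y hy z hz hyz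
      exact ⟨hb j (hJ'J hj) y (hYX hy) z (hYX hz) hyz this,
        hl j (hJ'J hj) y (hYX hy) z (hYX hz) hyz this⟩
    · refine hfree y (hY hy) z (hY hz) w (hY hw) hyz hwy hwz
        (Finset.mem_union_left _ (Finset.mem_filter.mpr ⟨hYX hw, ?_, ?_⟩))
      · exact (hB j hj y (hYX hy) z (hYX hz)).mpr (hYH j hj y hy z hz hyz)
      · exact (hT j hj y (hYX hy) z (hYX hz) w (hYX hw)).mpr hit
  · refine ⟨Y, (hY.trans hX₁X).trans hXX₀, hYc, J', hJ'J, (Nat.le_add_right _ _).trans hJ',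
      fun j hj y hy z hz hyz h => hq y hy z hz hyz ?_⟩
    have hy' := hX₁X (hY hy)
    have hz' := hX₁X (hY hz)
    exact (hB j₀ hj₀ y hy' z hz').mp ((hB j hj y hy' z hz').mpr h)

open Classical in
/-- If the vertices satisfying `H j` have holes on the `j`th path hit by few vertices, then there
is a large set of vertices not satisfying `H j`, for many `j`. -/
theorem exists_large_of_holes (c o m n l : ℕ) : ∃ N L : ℕ, ∀ W : PathSystem.{u},
    IsPerforated W.G c o → ∀ (X : Finset W.V) (J : Finset W.ι) (H : W.ι → W.V → Prop),
    (X : Set W.V) ⊆ W.S →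
    (∀ j ∈ J, ∀ y ∈ X, H j y → ∃ a b, b ≤ W.len j ∧ W.Hole o j a b y ∧
      ∀ Y ⊆ X, (∀ w ∈ Y, W.Hit j a b w) → Y.card ≤ m) →
    N ≤ X.card → L ≤ J.card →
    ∃ X' ⊆ X, n ≤ X'.card ∧ ∃ J' ⊆ J, l ≤ J'.card ∧ ∀ j ∈ J', ∀ y ∈ X', ¬ H j y := by
  obtain ⟨M, hM⟩ := exists_free_set m c
  refine ⟨M + n, 2 ^ ((M + n) * (M + n)) * 2 ^ (M + n) * (l + c),
    fun W hperf X₀ J H hX₀S hH₀ hX₀ hJ => ?_⟩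
  obtain ⟨X, hXX₀, hXc⟩ := Finset.exists_subset_card_eq hX₀
  have hXS : (X : Set W.V) ⊆ W.S := (Finset.coe_subset.mpr hXX₀).trans hX₀S
  have hH : ∀ j ∈ J, ∀ y ∈ X, H j y → ∃ a b, b ≤ W.len j ∧
      W.Hole o j a b y ∧ ∀ Y ⊆ X, (∀ w ∈ Y, W.Hit j a b w) → Y.card ≤ m := by
    intro j hj y hy h
    obtain ⟨a, b, h₁, h₂, h₃⟩ := hH₀ j hj y (hXX₀ hy) h
    exact ⟨a, b, h₁, h₂, fun Y hY => h₃ Y (hY.trans hXX₀)⟩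
  choose! a b hb hl hm using hH
  obtain ⟨J', hJ'J, ⟨T, B⟩, -, hJ', hφ⟩ := exists_large_fiber J
    ((X ×ˢ X).powerset ×ˢ X.powerset)
    (fun j => ((X ×ˢ X).filter (fun q => W.Hit j (a j q.1) (b j q.1) q.2),
      X.filter (fun q => H j q))) (l + c)
    (fun j _ => by
      rw [Finset.mem_product]
      exact ⟨Finset.mem_powerset.mpr (Finset.filter_subset _ _),
        Finset.mem_powerset.mpr (Finset.filter_subset _ _)⟩)
    ⟨(∅, ∅), by simp⟩
    (by simpa only [Finset.card_product, Finset.card_powerset, hXc] using hJ)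
  have hT : ∀ j ∈ J', ∀ y ∈ X, ∀ w ∈ X, (y, w) ∈ T ↔ W.Hit j (a j y) (b j y) w := by
    intro j hj y hy w hw
    rw [← (Prod.mk.inj (hφ j hj)).1]
    simp [hy, hw]
  have hB : ∀ j ∈ J', ∀ y ∈ X, y ∈ B ↔ H j y := by
    intro j hj y hy
    rw [← (Prod.mk.inj (hφ j hj)).2]
    simp [hy]
  have hc := hperf.pos
  obtain ⟨j₀, hj₀⟩ : J'.Nonempty := Finset.card_pos.mp (by omega)
  have hsplit : (X.filter (· ∈ B)).card + (X.filter (· ∉ B)).card = X.card :=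
    Finset.card_filter_add_card_filter_not _
  -- If `M` vertices have holes, a free set of `c` of them, with holes taken on `c` different paths,
  -- gives `c` separated cycles.
  rcases le_or_gt M (X.filter (· ∈ B)).card with h | h
  · exfalso
    obtain ⟨Y, hY, hYc, hfree⟩ := hM (X.filter (· ∈ B)) (fun y => X.filter (fun w => (y, w) ∈ T))
      (fun y hy => by
        have hy' := Finset.mem_filter.mp hy
        refine hm j₀ (hJ'J hj₀) y hy'.1 ((hB j₀ hj₀ y hy'.1).mp hy'.2) _
          (Finset.filter_subset _ _) fun w hw => ?_
        have hw' := Finset.mem_filter.mp hw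
        exact (hT j₀ hj₀ y hy'.1 w hw'.1).mp hw'.2) h
    have hYX : ∀ y ∈ Y, y ∈ X := fun y hy => (Finset.mem_filter.mp (hY hy)).1
    have hYB : ∀ y ∈ Y, y ∈ B := fun y hy => (Finset.mem_filter.mp (hY hy)).2
    obtain ⟨e, heY, he⟩ := exists_seq_of_le_card Y c hc hYc
    obtain ⟨ρ, hρJ, hρ⟩ := exists_seq_of_le_card J' c hc ((Nat.le_add_left _ _).trans hJ')
    have hHe : ∀ i < c, H (ρ i) (e i) := fun i hi =>
      (hB _ (hρJ i hi) _ (hYX _ (heY i hi))).mp (hYB _ (heY i hi))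
    have hbe : ∀ i < c, b (ρ i) (e i) ≤ W.len (ρ i) := fun i hi =>
      hb _ (hJ'J (hρJ i hi)) _ (hYX _ (heY i hi)) (hHe i hi)
    have hmiss : ∀ i < c, ∀ i' < c, i ≠ i' →
        ¬ W.Hit (ρ i) (a (ρ i) (e i)) (b (ρ i) (e i)) (e i') := fun i hi i' hi' hii' hit =>
      hfree _ (heY i hi) _ (heY i' hi') (fun h => hii' (he i hi i' hi' h))
        (Finset.mem_filter.mpr ⟨hYX _ (heY i' hi'),
          (hT _ (hρJ i hi) _ (hYX _ (heY i hi)) _ (hYX _ (heY i' hi'))).mpr hit⟩)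
    have hsub : ∀ i < c, ({e i} : Set W.V) ⊆ W.S := fun i hi =>
      Set.singleton_subset_iff.mpr (hXS (hYX _ (heY i hi)))
    refine (HasCycles.of_family (G := W.G) (o := o) (fun i => {e i} ∪
        W.cells {q | q.1 = ρ i ∧ a (ρ i) (e i) ≤ q.2 ∧ q.2 ≤ b (ρ i) (e i)}) c
      (fun i hi => ?_) (fun i hi i' hi' hii' => ?_)).not_isPerforated hperf
    · exact (hl _ (hJ'J (hρJ i hi)) _ (hYX _ (heY i hi)) (hHe i hi)).hasCycles (hbe i hi)
        (hXS (hYX _ (heY i hi)))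
    · refine separated_of_disjoint (hsub i hi) (hsub i' hi') ?_ ?_ ?_ ?_ ?_ ?_
      · rintro ⟨j, p⟩ ⟨rfl, _, h⟩
        exact h.trans (hbe i hi)
      · rintro ⟨j, p⟩ ⟨rfl, _, h⟩
        exact h.trans (hbe i' hi')
      · rintro x rfl y rfl h
        exact hii' (he i hi i' hi' h)
      · rintro ⟨j, p⟩ ⟨rfl, _, _⟩ ⟨j', p'⟩ ⟨rfl, _, _⟩ h
        exact hii' (hρ i hi i' hi' h)
      · rintro x rfl ⟨j, p⟩ ⟨rfl, h₁, h₂⟩ h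
        exact hmiss i' hi' i hi hii'.symm ⟨p, h₁, h₂, h⟩
      · rintro x rfl ⟨j, p⟩ ⟨rfl, h₁, h₂⟩ h
        exact hmiss i hi i' hi' hii' ⟨p, h₁, h₂, h⟩
  · refine ⟨X.filter (· ∉ B), (Finset.filter_subset _ _).trans hXX₀, by omega, J', hJ'J,
      (Nat.le_add_right _ _).trans hJ', fun j hj y hy hHy => ?_⟩
    have hy' := Finset.mem_filter.mp hy
    exact hy'.2 ((hB j hj y hy'.1).mpr hHy)

end PathSystem

/-! ### Ample systems and interrupters -/

theorem HasCycles.mono {V : Type u} {G : SimpleGraph V} {o c : ℕ} {Z Z' : Set V}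
    (h : HasCycles G o c Z) (hZ : Z ⊆ Z') : HasCycles G o c Z' :=
  h.imp fun _ hH => ⟨fun i => ⟨(hH.1 i).1, (hH.1 i).2.trans hZ⟩, hH.2⟩

namespace PathSystem

variable {W : PathSystem.{u}}

/-- Every vertex of `X` hits each of the segments `[lo j, hi j]`, and each vertex in the segments
is adjacent to at most one vertex of `X`. -/
structure IsAmpleOn (X : Finset W.V) (J : Finset W.ι) (lo hi : W.ι → ℕ) : Prop where
  subset : (X : Set W.V) ⊆ W.S
  le_len : ∀ j ∈ J, hi j ≤ W.len j
  hit : ∀ j ∈ J, ∀ x ∈ X, W.Hit j (lo j) (hi j) x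
  ample : ∀ j ∈ J, ∀ p, lo j ≤ p → p ≤ hi j → ∀ x ∈ X, ∀ y ∈ X,
    W.G.Adj x (W.pt j p) → W.G.Adj y (W.pt j p) → x = y

theorem IsAmpleOn.mono {X X' : Finset W.V} {J J' : Finset W.ι} {lo hi lo' hi' : W.ι → ℕ}
    (h : IsAmpleOn X J lo hi) (hX : X' ⊆ X) (hJ : J' ⊆ J)
    (hI : ∀ j ∈ J', lo j ≤ lo' j ∧ hi' j ≤ hi j)
    (hit : ∀ j ∈ J', ∀ x ∈ X', W.Hit j (lo' j) (hi' j) x) : IsAmpleOn X' J' lo' hi' where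
  subset := (Finset.coe_subset.mpr hX).trans h.subset
  le_len j hj := (hI j hj).2.trans (h.le_len j (hJ hj))
  hit := hit
  ample j hj p h₁ h₂ x hx y hy := h.ample j (hJ hj) p ((hI j hj).1.trans h₁)
    (h₂.trans (hI j hj).2) x (hX hx) y (hX hy)

theorem IsAmpleOn.subsystem {X X' : Finset W.V} {J J' : Finset W.ι} {lo hi : W.ι → ℕ}
    (h : IsAmpleOn X J lo hi) (hX : X' ⊆ X) (hJ : J' ⊆ J) : IsAmpleOn X' J' lo hi :=
  h.mono hX hJ (fun _ _ => ⟨le_rfl, le_rfl⟩) fun j hj x hx => h.hit j (hJ hj) x (hX hx)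

/-- The vertex `d` hits all links between vertices of `X`, and all holes of vertices of `X`,
within the segment `[a, b]` of the `j`th path. -/
def Interrupts (o : ℕ) (d : W.V) (X : Set W.V) (j : W.ι) (a b : ℕ) : Prop :=
  (∀ y ∈ X, ∀ z ∈ X, y ≠ z → ∀ a' b', a ≤ a' → b' ≤ b → W.Linked j a' b' y z → W.Hit j a' b' d) ∧
  ∀ y ∈ X, ∀ a' b', a ≤ a' → b' ≤ b → W.Hole o j a' b' y → W.Hit j a' b' d

theorem Interrupts.mono {o : ℕ} {d : W.V} {X X' : Set W.V} {j : W.ι} {a b a' b' : ℕ}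
    (h : Interrupts o d X j a b) (hX : X' ⊆ X) (ha : a ≤ a') (hb : b' ≤ b) :
    Interrupts o d X' j a' b' :=
  ⟨fun y hy z hz hyz _ _ h₁ h₂ => h.1 y (hX hy) z (hX hz) hyz _ _ (ha.trans h₁) (h₂.trans hb),
    fun y hy _ _ h₁ h₂ => h.2 y (hX hy) _ _ (ha.trans h₁) (h₂.trans hb)⟩

/-- There is a subsystem of prescribed size interrupted by a further vertex. -/
def HasInterrupter (o n l : ℕ) (U : Finset W.V) (J : Finset W.ι) (lo hi : W.ι → ℕ) : Prop :=
  ∃ d ∈ U, ∃ X ⊆ U, d ∉ X ∧ n ≤ X.card ∧ ∃ J' ⊆ J, l ≤ J'.card ∧ ∃ lo' hi' : W.ι → ℕ,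
    (∀ j ∈ J', lo j ≤ lo' j ∧ hi' j ≤ hi j) ∧ IsAmpleOn X J' lo' hi' ∧
    ∀ j ∈ J', Interrupts o d X j (lo' j) (hi' j)

theorem HasInterrupter.mono {o n l : ℕ} {U : Finset W.V} {J J' : Finset W.ι}
    {lo hi lo' hi' : W.ι → ℕ} (h : HasInterrupter o n l U J' lo' hi') (hJ : J' ⊆ J)
    (hI : ∀ j ∈ J', lo j ≤ lo' j ∧ hi' j ≤ hi j) : HasInterrupter o n l U J lo hi := by
  obtain ⟨d, hd, X, hX, hdX, hn, J'', hJ'', hl, lo'', hi'', hI'', h₁, h₂⟩ := h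
  exact ⟨d, hd, X, hX, hdX, hn, J'', hJ''.trans hJ, hl, lo'', hi'', fun j hj =>
    ⟨(hI j (hJ'' hj)).1.trans (hI'' j hj).1, (hI'' j hj).2.trans (hI j (hJ'' hj)).2⟩, h₁, h₂⟩

open Classical in
/-- In the absence of interrupters, one can pass to segments that miss a given vertex. -/
theorem exists_segments_missing (c o n l m μ : ℕ) : ∃ N L : ℕ, ∀ W : PathSystem.{u},
    IsPerforated W.G c o → ∀ (U X : Finset W.V) (J : Finset W.ι) (lo hi : W.ι → ℕ) (d : W.V),
    IsAmpleOn X J lo hi → d ∈ U → X ⊆ U → d ∉ X → N ≤ X.card → L ≤ J.card →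
    ¬ HasInterrupter o n l U J lo hi →
    ∃ X' ⊆ X, m ≤ X'.card ∧ ∃ J' ⊆ J, μ ≤ J'.card ∧ ∃ lo' hi' : W.ι → ℕ,
      (∀ j ∈ J', lo j ≤ lo' j ∧ hi' j ≤ hi j) ∧ IsAmpleOn X' J' lo' hi' ∧
      ∀ j ∈ J', ¬ W.Hit j (lo' j) (hi' j) d := by
  obtain ⟨N₁, L₁, h₁⟩ := exists_large_of_holes.{u} c o m n l
  obtain ⟨N₂, L₂, h₂⟩ := exists_stable_of_linked.{u} c o m N₁ L₁
  refine ⟨N₂, 2 ^ N₂ * (μ + 1) + L₂,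
    fun W hperf U X₀ J lo hi d hsys₀ hdU hX₀U hdX₀ hX₀ hJ hno => ?_⟩
  obtain ⟨X, hXX₀, hXc⟩ := Finset.exists_subset_card_eq hX₀
  have hsys := hsys₀.subsystem hXX₀ (subset_refl J)
  let rich : W.ι → Prop := fun j => ∃ a b, ∃ Y ⊆ X, lo j ≤ a ∧ b ≤ hi j ∧ ¬ W.Hit j a b d ∧
    m ≤ Y.card ∧ ∀ w ∈ Y, W.Hit j a b w
  have hsplit : (J.filter rich).card + (J.filter (fun j => ¬ rich j)).card = J.card :=
    Finset.card_filter_add_card_filter_not _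
  -- With many rich paths, pigeonhole fixes one set of vertices hitting segments that miss `d`; the
  -- extra `1` makes the fiber nonempty even if `μ = 0`. On the other paths, any link or hole
  -- missing `d` is hit by at most `m` vertices, so both kinds can be eliminated in turn, and `d`
  -- becomes an interrupter.
  rcases le_or_gt (2 ^ N₂ * (μ + 1)) (J.filter rich).card with h | h
  · have hr : ∀ j ∈ J.filter rich, rich j := fun j hj => (Finset.mem_filter.mp hj).2
    simp only [rich] at hr
    choose! a b Y hYX ha hb hd hm hY using hr
    obtain ⟨J', hJ', Y₀, hY₀, hμ, hc⟩ := exists_large_fiber (J.filter rich) X.powerset Y (μ + 1)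
      (fun j hj => Finset.mem_powerset.mpr (hYX j hj)) ⟨∅, by simp⟩
      (by rwa [Finset.card_powerset, hXc])
    obtain ⟨j₀, hj₀⟩ : J'.Nonempty := Finset.card_pos.mp (by omega)
    have hJ'J := hJ'.trans (Finset.filter_subset _ _)
    have hY₀X := Finset.mem_powerset.mp hY₀
    exact ⟨Y₀, hY₀X.trans hXX₀, hc j₀ hj₀ ▸ hm j₀ (hJ' hj₀), J', hJ'J, by omega, a, b,
      fun j hj => ⟨ha j (hJ' hj), hb j (hJ' hj)⟩,
      hsys.mono hY₀X hJ'J (fun j hj => ⟨ha j (hJ' hj), hb j (hJ' hj)⟩)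
        (fun j hj x hx => hY j (hJ' hj) x ((hc j hj).symm ▸ hx)), fun j hj => hd j (hJ' hj)⟩
  · exfalso
    have hpoor : ∀ j ∈ J.filter (fun j => ¬ rich j), j ∈ J ∧ ∀ a b, lo j ≤ a → b ≤ hi j →
        ¬ W.Hit j a b d → ∀ Y ⊆ X, (∀ w ∈ Y, W.Hit j a b w) → Y.card ≤ m := by
      intro j hj
      have hj' := Finset.mem_filter.mp hj
      refine ⟨hj'.1, fun a b ha hb hd Y hYX hY => ?_⟩
      by_contra hm
      exact hj'.2 ⟨a, b, Y, hYX, ha, hb, hd, by omega, hY⟩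
    obtain ⟨X₁, hX₁X, hX₁, J₁, hJ₁J, hJ₁, hst₁⟩ := h₂ W hperf X (J.filter (fun j => ¬ rich j))
      (fun j y z => ∃ a b, lo j ≤ a ∧ b ≤ hi j ∧ W.Linked j a b y z ∧ ¬ W.Hit j a b d)
      hsys.subset (fun j y z ⟨a, b, ha, hb, hl, hd⟩ => ⟨a, b, ha, hb, hl.symm, hd⟩)
      (fun j hj y _ z _ _ ⟨a, b, ha, hb, hl, hd⟩ =>
        ⟨a, b, hb.trans (hsys.le_len j (hpoor j hj).1), hl, (hpoor j hj).2 a b ha hb hd⟩)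
      hXc.ge (by omega)
    obtain ⟨X₂, hX₂X, hX₂, J₂, hJ₂J, hJ₂, hst₂⟩ := h₁ W hperf X₁ J₁
      (fun j y => ∃ a b, lo j ≤ a ∧ b ≤ hi j ∧ W.Hole o j a b y ∧ ¬ W.Hit j a b d)
      ((Finset.coe_subset.mpr hX₁X).trans hsys.subset)
      (fun j hj y _ ⟨a, b, ha, hb, hl, hd⟩ =>
        ⟨a, b, hb.trans (hsys.le_len j (hpoor j (hJ₁J hj)).1), hl, fun Y hY =>
          (hpoor j (hJ₁J hj)).2 a b ha hb hd Y (hY.trans hX₁X)⟩) hX₁ hJ₁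
    have hX₂X₀ : X₂ ⊆ X := hX₂X.trans hX₁X
    have hJ₂J₀ : J₂ ⊆ J := hJ₂J.trans (hJ₁J.trans (Finset.filter_subset _ _))
    refine hno ⟨d, hdU, X₂, hX₂X₀.trans (hXX₀.trans hX₀U), fun hd => hdX₀ (hXX₀ (hX₂X₀ hd)), hX₂,
      J₂, hJ₂J₀, hJ₂, lo, hi, fun _ _ => ⟨le_rfl, le_rfl⟩, hsys.subsystem hX₂X₀ hJ₂J₀,
      fun j hj => ⟨fun y hy z hz hyz a b ha hb hl => ?_, fun y hy a b ha hb hl => ?_⟩⟩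
    · by_contra hd
      exact hst₁ j (hJ₂J hj) y (hX₂X hy) z (hX₂X hz) hyz ⟨a, b, ha, hb, hl, hd⟩
    · by_contra hd
      exact hst₂ j hj y hy ⟨a, b, ha, hb, hl, hd⟩

open Classical in
/-- In the absence of interrupters, one can pass to segments that miss a given set. -/
theorem exists_segments_missing_set (c o n l δ m μ : ℕ) : ∃ N L : ℕ, ∀ W : PathSystem.{u},
    IsPerforated W.G c o → ∀ (U X D : Finset W.V) (J : Finset W.ι) (lo hi : W.ι → ℕ),
    IsAmpleOn X J lo hi → D ⊆ U → X ⊆ U → Disjoint D X → D.card ≤ δ → N ≤ X.card → L ≤ J.card →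
    ¬ HasInterrupter o n l U J lo hi →
    ∃ X' ⊆ X, m ≤ X'.card ∧ ∃ J' ⊆ J, μ ≤ J'.card ∧ ∃ lo' hi' : W.ι → ℕ,
      (∀ j ∈ J', lo j ≤ lo' j ∧ hi' j ≤ hi j) ∧ IsAmpleOn X' J' lo' hi' ∧
      ∀ j ∈ J', ∀ d ∈ D, ¬ W.Hit j (lo' j) (hi' j) d := by
  induction δ with
  | zero =>
    refine ⟨m, μ, fun W _ U X D J lo hi hsys _ _ _ hD hX hJ _ => ⟨X, subset_rfl, hX, J, subset_rfl,
      hJ, lo, hi, fun _ _ => ⟨le_rfl, le_rfl⟩, hsys, fun j _ d hd => ?_⟩⟩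
    rw [Finset.card_eq_zero.mp (Nat.le_zero.mp hD)] at hd
    simp at hd
  | succ δ ih =>
    obtain ⟨N₁, L₁, h₁⟩ := ih
    obtain ⟨N₂, L₂, h₂⟩ := exists_segments_missing.{u} c o n l N₁ L₁
    refine ⟨max N₁ N₂, max L₁ L₂, fun W hperf U X D J lo hi hsys hDU hXU hDX hD hX hJ hno => ?_⟩
    rcases D.eq_empty_or_nonempty with rfl | ⟨d, hd⟩
    · exact h₁ W hperf U X ∅ J lo hi hsys hDU hXU hDX (by simp) (by omega) (by omega) hno
    · obtain ⟨X', hX', hm, J', hJ', hμ, lo', hi', hI, hsys', hmiss⟩ := h₂ W hperf U X J lo hi d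
        hsys (hDU hd) hXU (Finset.disjoint_left.mp hDX hd) (by omega) (by omega) hno
      have hc := Finset.card_erase_add_one hd
      obtain ⟨X'', hX'', hm', J'', hJ'', hμ', lo'', hi'', hI', hsys'', hmiss'⟩ :=
        h₁ W hperf U X' (D.erase d) J' lo' hi' hsys' ((Finset.erase_subset _ _).trans hDU)
          (hX'.trans hXU) (hDX.mono (Finset.erase_subset _ _) hX') (by omega) hm hμ
          (fun h => hno (h.mono hJ' hI))
      refine ⟨X'', hX''.trans hX', hm', J'', hJ''.trans hJ', hμ', lo'', hi'', fun j hj =>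
        ⟨(hI j (hJ'' hj)).1.trans (hI' j hj).1, (hI' j hj).2.trans (hI j (hJ'' hj)).2⟩, hsys'',
        fun j hj e he => ?_⟩
      by_cases hed : e = d
      · subst hed
        exact fun h => hmiss j (hJ'' hj) (h.mono (hI' j hj).1 (hI' j hj).2)
      · exact hmiss' j hj e (Finset.mem_erase.mpr ⟨hed, he⟩)

open Classical in
/-- A large system has a long cycle through two vertices of the stable set and two paths. -/
theorem exists_cycle_of_isAmpleOn (o : ℕ) : ∃ N L : ℕ, ∀ (W : PathSystem.{u}) (X : Finset W.V)
    (J : Finset W.ι) (lo hi : W.ι → ℕ), IsAmpleOn X J lo hi → N ≤ X.card → L ≤ J.card →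
    ∃ x ∈ X, ∃ y ∈ X, ∃ i ∈ J, ∃ j ∈ J, HasCycles W.G o 1 (({x, y} : Finset W.V) ∪
      W.cells {q | (q.1 = i ∨ q.1 = j) ∧ lo q.1 ≤ q.2 ∧ q.2 ≤ hi q.1}) := by
  -- A shortest segment hit by `o + 2` vertices is a link with at least `o + 2` vertices. Two paths
  -- whose links have the same ordered pair of vertices form the cycle, the second link being
  -- traversed backwards.
  refine ⟨o + 2, (o + 2) * (o + 2) * 2, fun W X₀ J lo hi hsys₀ hX₀ hJ => ?_⟩
  obtain ⟨X, hXX₀, hXc⟩ := Finset.exists_subset_card_eq hX₀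
  have hsys := hsys₀.subsystem hXX₀ (subset_refl J)
  have hl := fun j hj => exists_link_of_hit (j := j) (lo := lo j) (hi := hi j) (by omega)
    (hsys.hit j hj) (hsys.ample j hj)
  obtain ⟨x₀, hx₀⟩ : X.Nonempty := Finset.card_pos.mp (by omega)
  have : Nonempty W.V := ⟨x₀⟩
  choose! a b ha hb hc x hx y hy hxy hlink using hl
  obtain ⟨J', hJ', ⟨x', y'⟩, -, hcard, hφ⟩ := exists_large_fiber J (X ×ˢ X) (fun j => (x j, y j)) 2
    (fun j hj => Finset.mem_product.mpr ⟨hx j hj, hy j hj⟩) ⟨(x₀, x₀), by simp [hx₀]⟩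
    (by rwa [Finset.card_product, hXc])
  obtain ⟨i, hi', j, hj', hij⟩ := Finset.one_lt_card.mp hcard
  have hxe : ∀ k ∈ J', x k = x' := fun k hk => (Prod.mk.inj (hφ k hk)).1
  have hye : ∀ k ∈ J', y k = y' := fun k hk => (Prod.mk.inj (hφ k hk)).2
  have hmem : ∀ k, k = i ∨ k = j → k ∈ J' := by
    rintro k (rfl | rfl) <;> assumption
  have hne : x' ≠ y' := by
    rw [← hxe i hi', ← hye i hi']
    exact hxy i (hJ' hi')
  let ρ : ℕ → W.ι := fun r => if r = 0 then i else j
  let e : ℕ → W.V := fun r => if r = 0 then x' else y'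
  have hρ : ∀ r, ρ r = i ∨ ρ r = j := by
    intro r
    simp only [ρ]
    split_ifs <;> simp
  have h01 : ∀ r ≤ 1, r = 0 ∨ r = 1 := fun r hr => by omega
  have hcyc : HasCycles W.G o 1 ({z | ∃ r ≤ 1, z = e r} ∪
      W.cells {q | ∃ r ≤ 1, q.1 = ρ r ∧ a (ρ r) ≤ q.2 ∧ q.2 ≤ b (ρ r)}) := by
    refine hasCycles_of_links le_rfl ρ e (fun r => a (ρ r)) (fun r => b (ρ r)) ?_ ?_ ?_ ?_ ?_ ?_ ?_
    · intro r hr r' hr' h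
      rcases h01 r hr with rfl | rfl <;> rcases h01 r' hr' with rfl | rfl <;>
        simp_all [ρ, Ne.symm]
    · intro r hr r' hr' h
      rcases h01 r hr with rfl | rfl <;> rcases h01 r' hr' with rfl | rfl
      · exact absurd rfl h
      · exact hne
      · exact hne.symm
      · exact absurd rfl h
    · intro r hr
      rcases h01 r hr with rfl | rfl
      · exact hsys.subset (hxe i hi' ▸ hx i (hJ' hi') : x' ∈ X)
      · exact hsys.subset (hye i hi' ▸ hy i (hJ' hi') : y' ∈ X)
    · intro r _
      have := hJ' (hmem _ (hρ r))
      exact (hb _ this).trans (hsys.le_len _ this)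
    · intro r hr
      have h := hlink _ (hJ' (hmem _ (hρ r)))
      rw [hxe _ (hmem _ (hρ r)), hye _ (hmem _ (hρ r))] at h
      rcases h01 r hr with rfl | rfl
      · exact Or.inl h
      · exact Or.inr h
    · intro r hr r' hr' h₁ h₂
      rcases h01 r hr with rfl | rfl <;> rcases h01 r' hr' with rfl | rfl <;> simp_all
    · have := hc _ (hJ' (hmem _ (hρ 0)))
      omega
  refine ⟨x', hXX₀ (hxe i hi' ▸ hx i (hJ' hi')), y', hXX₀ (hye i hi' ▸ hy i (hJ' hi')), i, hJ' hi',
    j, hJ' hj', hcyc.mono ?_⟩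
  rintro v (⟨r, hr, rfl⟩ | ⟨⟨k, p⟩, ⟨r, hr, rfl, h₁, h₂⟩, rfl⟩)
  · left
    rcases h01 r hr with rfl | rfl <;> simp [e]
  · have := hJ' (hmem _ (hρ r))
    exact Or.inr ⟨(ρ r, p), ⟨hρ r, (ha _ this).trans h₁, h₂.trans (hb _ this)⟩, rfl⟩

end PathSystem

/-! ### Existence and iteration of interrupters -/

namespace PathSystem

variable {W : PathSystem.{u}}

open Classical in
/-- In the absence of interrupters, one finds any number of separated long cycles, missed by a
large remaining system. -/
theorem exists_cycles_of_not_hasInterrupter (c o n l i : ℕ) : ∀ r μ : ℕ, ∃ N L : ℕ,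
    ∀ W : PathSystem.{u}, IsPerforated W.G c o →
    ∀ (X : Finset W.V) (J : Finset W.ι) (lo hi : W.ι → ℕ),
    IsAmpleOn X J lo hi → N ≤ X.card → L ≤ J.card → ¬ HasInterrupter o n l X J lo hi →
    ∃ E ⊆ X, E.card ≤ 2 * i ∧ ∃ D ⊆ X, r ≤ D.card ∧ Disjoint E D ∧ ∃ J' ⊆ J, μ ≤ J'.card ∧
      ∃ T : Set (W.ι × ℕ), (∀ q ∈ T, q.1 ∉ J' ∧ q.2 ≤ W.len q.1 ∧
        ∀ x ∈ D, ¬ W.G.Adj x (W.pt q.1 q.2)) ∧ HasCycles W.G o i (E ∪ W.cells T) := by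
  induction i with
  | zero =>
    intro r μ
    refine ⟨r, μ, fun W _ X J lo hi _ hX hJ _ => ⟨∅, by simp, by simp, X, subset_rfl, hX, by simp, J,
      subset_rfl, hJ, ∅, by simp, HasCycles.zero _ _ _⟩⟩
  | succ i ih =>
    intro r μ
    obtain ⟨N₀, L₀, h₀⟩ := exists_cycle_of_isAmpleOn.{u} o
    obtain ⟨N₁, L₁, h₁⟩ := exists_segments_missing_set.{u} c o n l r N₀ (L₀ + (μ + 2))
    obtain ⟨N₂, L₂, h₂⟩ := exists_segments_missing_set.{u} c o n l (2 * i) (r + N₁) L₁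
    obtain ⟨N, L, h⟩ := ih N₂ L₂
    refine ⟨N, L, fun W hperf X J lo hi hsys hX hJ hno => ?_⟩
    obtain ⟨E, hEX, hE, D, hDX, hD, hED, J₁, hJ₁J, hJ₁, T, hT, hcyc⟩ :=
      h W hperf X J lo hi hsys hX hJ hno
    -- Pass to segments missed by the vertices `E` of the earlier cycles. The original `lo` and `hi`
    -- are still valid for `D` and `J₁`, since the earlier cycles only used up vertices and paths.
    obtain ⟨D₂, hD₂D, hD₂, J₂, hJ₂J₁, hJ₂, lo₂, hi₂, hI₂, hsys₂, hmiss₂⟩ :=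
      h₂ W hperf X D E J₁ lo hi (hsys.subsystem hDX hJ₁J) hEX hDX hED hE hD hJ₁
        (fun h => hno (h.mono hJ₁J fun _ _ => ⟨le_rfl, le_rfl⟩))
    -- `A` is reserved as the new remainder. The next cycle is built from `D₂ \ A` on segments that
    -- also miss `A`, and uses up two paths.
    obtain ⟨A, hAD, hA⟩ := Finset.exists_subset_card_eq (show r ≤ D₂.card by omega)
    have hAc := Finset.card_sdiff_add_card_eq_card hAD
    have hAX := hAD.trans (hD₂D.trans hDX)
    obtain ⟨B, hBD, hB, J₃, hJ₃J₂, hJ₃, lo₃, hi₃, hI₃, hsys₃, hmiss₃⟩ :=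
      h₁ W hperf X (D₂ \ A) A J₂ lo₂ hi₂ (hsys₂.subsystem Finset.sdiff_subset subset_rfl) hAX
        (Finset.sdiff_subset.trans (hD₂D.trans hDX)) Finset.disjoint_sdiff hA.le (by omega) hJ₂
        (fun h => hno (h.mono (hJ₂J₁.trans hJ₁J) hI₂))
    obtain ⟨x, hx, y, hy, j₁, hj₁, j₂, hj₂, hxy⟩ := h₀ W B J₃ lo₃ hi₃ hsys₃ hB (by omega)
    have hBD₂ : B ⊆ D₂ := hBD.trans Finset.sdiff_subset
    have hBD' : B ⊆ D := hBD₂.trans hD₂D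
    have hxyB : ({x, y} : Finset W.V) ⊆ B := by
      intro z hz
      rcases Finset.mem_insert.mp hz with rfl | hz
      · exact hx
      · exact (Finset.mem_singleton.mp hz) ▸ hy
    have hq : ∀ q : W.ι × ℕ, ((q.1 = j₁ ∨ q.1 = j₂) ∧ lo₃ q.1 ≤ q.2 ∧ q.2 ≤ hi₃ q.1) →
        q.1 ∈ J₃ := by
      rintro ⟨j, p⟩ ⟨rfl | rfl, -⟩ <;> assumption
    have hJ' : J₃ \ {j₁, j₂} ⊆ J₃ := Finset.sdiff_subset
    have hJ'' := hJ'.trans hJ₃J₂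
    refine ⟨E ∪ {x, y}, Finset.union_subset hEX (hxyB.trans (hBD'.trans hDX)), ?_, A, hAX, hA.ge,
      ?_, J₃ \ {j₁, j₂}, hJ''.trans (hJ₂J₁.trans hJ₁J), ?_,
      T ∪ {q | (q.1 = j₁ ∨ q.1 = j₂) ∧ lo₃ q.1 ≤ q.2 ∧ q.2 ≤ hi₃ q.1}, ?_, ?_⟩
    · have := Finset.card_union_le E {x, y}
      have := Finset.card_le_two (a := x) (b := y)
      omega
    · refine Finset.disjoint_union_left.mpr ⟨hED.mono_right (hAD.trans hD₂D), ?_⟩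
      refine Finset.disjoint_left.mpr fun z hz => ?_
      exact (Finset.mem_sdiff.mp (hBD (hxyB hz))).2
    · have := Finset.le_card_sdiff {j₁, j₂} J₃
      have := Finset.card_le_two (a := j₁) (b := j₂)
      omega
    · rintro q (hqT | hqT)
      · obtain ⟨ha, hb, hc⟩ := hT q hqT
        exact ⟨fun h => ha (hJ₂J₁ (hJ'' h)), hb, fun z hz => hc z (hD₂D (hAD hz))⟩
      · have hq₃ := hq q hqT
        refine ⟨fun h => (Finset.mem_sdiff.mp h).2 ?_, hqT.2.2.trans (hsys₃.le_len _ hq₃),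
          fun z hz hzq => hmiss₃ _ hq₃ z hz ⟨q.2, hqT.2.1, hqT.2.2, hzq⟩⟩
        rw [Finset.mem_insert, Finset.mem_singleton]
        exact hqT.1
    · have hsep := separated_of_disjoint (W := W) (E := E) (E' := ({x, y} : Finset W.V)) (T := T)
        (T' := {q | (q.1 = j₁ ∨ q.1 = j₂) ∧ lo₃ q.1 ≤ q.2 ∧ q.2 ≤ hi₃ q.1})
        ((Finset.coe_subset.mpr hEX).trans hsys.subset)
        ((Finset.coe_subset.mpr hxyB).trans hsys₃.subset)
        (fun q hq => (hT q hq).2.1) (fun q hqT => hqT.2.2.trans (hsys₃.le_len _ (hq q hqT)))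
        (fun z hz w hw h => Finset.disjoint_left.mp hED hz (h ▸ hBD' (hxyB hw)))
        (fun q hqT q' hqT' h => (hT q hqT).1 (h ▸ hJ₂J₁ (hJ₃J₂ (hq q' hqT'))))
        (fun z hz q hqT hzq => hmiss₂ _ (hJ₃J₂ (hq q hqT)) z hz
          ⟨q.2, (hI₃ _ (hq q hqT)).1.trans hqT.2.1, hqT.2.2.trans (hI₃ _ (hq q hqT)).2, hzq⟩)
        (fun z hz q hqT => (hT q hqT).2.2 z (hBD' (hxyB hz)))
      refine (hcyc.succ hxy hsep.1 hsep.2).mono ?_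
      rintro v ((hv | ⟨q, hqT, rfl⟩) | (hv | ⟨q, hqT, rfl⟩))
      · exact Or.inl (by simp [Finset.mem_coe.mp hv])
      · exact Or.inr ⟨q, Or.inl hqT, rfl⟩
      · exact Or.inl (Finset.mem_coe.mpr (Finset.mem_union_right _ hv))
      · exact Or.inr ⟨q, Or.inr hqT, rfl⟩

/-- A large system in a perforated graph has an interrupter. -/
theorem exists_interrupter (c o n l : ℕ) : ∃ N L : ℕ,
    ∀ W : PathSystem.{u}, IsPerforated W.G c o →
    ∀ (X : Finset W.V) (J : Finset W.ι) (lo hi : W.ι → ℕ),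
    IsAmpleOn X J lo hi → N ≤ X.card → L ≤ J.card → HasInterrupter o n l X J lo hi := by
  obtain ⟨N, L, h⟩ := exists_cycles_of_not_hasInterrupter.{u} c o n l c 0 0
  refine ⟨N, L, fun W hperf X J lo hi hsys hX hJ => ?_⟩
  by_contra hno
  obtain ⟨E, -, -, D, -, -, -, J', -, -, T, -, hc⟩ := h W hperf X J lo hi hsys hX hJ hno
  exact hc.not_isPerforated hperf

/-- A large system in a perforated graph contains a segment of a path and a sequence of vertices
of the stable set, each of which interrupts its predecessors on the segment. -/
theorem exists_interrupting_seq (c o s : ℕ) : ∃ N L : ℕ,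
    ∀ W : PathSystem.{u}, IsPerforated W.G c o →
    ∀ (X : Finset W.V) (J : Finset W.ι) (lo hi : W.ι → ℕ),
    IsAmpleOn X J lo hi → N ≤ X.card → L ≤ J.card →
    ∃ j ∈ J, ∃ a b, lo j ≤ a ∧ b ≤ hi j ∧ ∃ x : ℕ → W.V, (∀ i < s + 2, x i ∈ X) ∧
      (∀ i < s + 2, ∀ k < s + 2, x i = x k → i = k) ∧ W.Link j a b (x 0) (x 1) ∧
      ∀ i, 2 ≤ i → i < s + 2 → Interrupts o (x i) (x '' {k | k < i}) j a b := by
  induction s with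
  | zero =>
    refine ⟨2, 1, fun W _ X J lo hi hsys hX hJ => ?_⟩
    obtain ⟨j, hj⟩ : J.Nonempty := Finset.card_pos.mp (by omega)
    obtain ⟨a, b, ha, hb, -, x, hx, y, hy, hxy, hl⟩ :=
      exists_link_of_hit hX (hsys.hit j hj) (hsys.ample j hj)
    refine ⟨j, hj, a, b, ha, hb, fun i => if i = 0 then x else y, fun i _ => ?_,
      fun i hi k hk h => ?_, by simpa using hl, fun i h₁ h₂ => by omega⟩
    · by_cases h : i = 0 <;> simp [h, hx, hy]
    · by_cases h₁ : i = 0 <;> by_cases h₂ : k = 0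
      · omega
      · exact absurd (by simpa [h₁, h₂] using h) hxy
      · exact absurd (by simpa [h₁, h₂] using h.symm) hxy
      · omega
  | succ s ih =>
    obtain ⟨N₁, L₁, h₁⟩ := ih
    obtain ⟨N, L, h⟩ := exists_interrupter.{u} c o N₁ L₁
    refine ⟨N, L, fun W hperf X J lo hi hsys hX hJ => ?_⟩
    obtain ⟨d, hd, X', hX', hdX', hN, J', hJ', hL, lo', hi', hI, hsys', hint⟩ :=
      h W hperf X J lo hi hsys hX hJ
    -- The interrupter found first becomes the last term: the recursion stays inside `X'` and the
    -- segments where `d` interrupts, and interruption passes to subsets and subsegments.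
    obtain ⟨j, hj, a, b, ha, hb, x, hxX, hx, hl, hxi⟩ := h₁ W hperf X' J' lo' hi' hsys' hN hL
    have hlt : ∀ i, i < s + 2 → (if i = s + 2 then d else x i) = x i := fun i hi =>
      if_neg (by omega)
    have him : ∀ i, i ≤ s + 2 → (fun i => if i = s + 2 then d else x i) '' {k | k < i} =
        x '' {k | k < i} := fun i hi =>
      Set.image_congr fun k hk => hlt k (lt_of_lt_of_le hk hi)
    refine ⟨j, hJ' hj, a, b, (hI j hj).1.trans ha, hb.trans (hI j hj).2,
      fun i => if i = s + 2 then d else x i, fun i hi => ?_, fun i hi k hk hik => ?_, ?_,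
      fun i h₁ h₂ => ?_⟩
    · rcases Nat.lt_succ_iff_lt_or_eq.mp hi with hi | rfl
      · simp only [hlt i hi]
        exact hX' (hxX i hi)
      · simpa using hd
    · simp only at hik
      rcases Nat.lt_succ_iff_lt_or_eq.mp hi with hi | rfl <;>
        rcases Nat.lt_succ_iff_lt_or_eq.mp hk with hk | rfl
      · rw [hlt i hi, hlt k hk] at hik
        exact hx i hi k hk hik
      · rw [hlt i hi, if_pos rfl] at hik
        exact absurd (hik ▸ hxX i hi) hdX'
      · rw [hlt k hk, if_pos rfl] at hik
        exact absurd (hik ▸ hxX k hk) hdX'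
      · rfl
    · simpa only [hlt 0 (by omega), hlt 1 (by omega)] using hl
    · rw [him i (by omega)]
      rcases Nat.lt_succ_iff_lt_or_eq.mp h₂ with hi | rfl
      · simp only [hlt i hi]
        exact hxi i h₁ hi
      · simp only [if_true]
        refine (hint j hj).mono ?_ ha hb
        rintro _ ⟨k, hk, rfl⟩
        exact hxX k hk

end PathSystem

/-! ### From interrupting sequences to occultations -/

namespace InducedPath

variable {V : Type u} {G : SimpleGraph V} (P : InducedPath G)

/-- The vertices of a path, listed in order (the last one being repeated). -/
def seq (p : ℕ) : V := P.toEmb ⟨min p P.length, by omega⟩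

theorem seq_of_lt (i : Fin (P.length + 1)) : P.seq i.val = P.toEmb i := by
  unfold seq
  congr 1
  apply Fin.ext
  simp only
  omega

theorem isPathSeq_seq : IsPathSeq G P.seq P.length := by
  refine ⟨fun p hp q hq h => ?_, fun p hp q hq => ?_⟩
  · have := congrArg Fin.val (P.toEmb.injective h)
    simp only at this
    omega
  · have h : G.Adj (P.seq p) (P.seq q) ↔ _ := P.toEmb.map_adj_iff
    rw [h, SimpleGraph.pathGraph_adj]
    simp only
    omega

theorem mem_verts_iff {v : V} : v ∈ P.verts ↔ ∃ p ≤ P.length, v = P.seq p := by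
  constructor
  · rintro ⟨i, rfl⟩
    exact ⟨i.val, by omega, (P.seq_of_lt i).symm⟩
  · rintro ⟨p, _, rfl⟩
    exact ⟨_, rfl⟩

theorem ends_eq : P.ends = {P.seq 0, P.seq P.length} := by
  have h₁ := P.seq_of_lt 0
  have h₂ := P.seq_of_lt (Fin.last P.length)
  rw [Fin.val_zero] at h₁
  rw [Fin.val_last] at h₂
  rw [ends, h₁, h₂]

end InducedPath

/-- The path listed by a sequence. -/
def IsPathSeq.toInducedPath {V : Type u} {G : SimpleGraph V} {v : ℕ → V} {n : ℕ}
    (h : IsPathSeq G v n) : InducedPath G where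
  length := n
  toEmb :=
    { toFun := fun i => v i.val
      inj' := fun i j e => Fin.ext (h.1 _ (by omega) _ (by omega) e)
      map_rel_iff' := by
        intro i j
        change G.Adj (v i.val) (v j.val) ↔ _
        rw [h.2 _ (by omega) _ (by omega), SimpleGraph.pathGraph_adj] }

/-- An injective sequence of integers with steps `±1` is monotone. -/
theorem eq_add_or_add_eq_of_step {f : ℕ → ℕ} {n : ℕ}
    (hinj : ∀ p ≤ n, ∀ q ≤ n, f p = f q → p = q)
    (hstep : ∀ p < n, f p + 1 = f (p + 1) ∨ f (p + 1) + 1 = f p) :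
    (∀ p ≤ n, f p = f 0 + p) ∨ ∀ p ≤ n, f p + p = f 0 := by
  induction n with
  | zero =>
    refine Or.inl fun p hp => ?_
    obtain rfl : p = 0 := by omega
    rfl
  | succ n ih =>
    have hs := hstep n (by omega)
    have hle : ∀ p, p ≤ n + 1 → p ≤ n ∨ p = n + 1 := fun p hp => by omega
    rcases Nat.eq_zero_or_pos n with rfl | hn
    · rcases hs with h | h
      · refine Or.inl fun p hp => ?_
        rcases hle p hp with h' | rfl
        · obtain rfl : p = 0 := by omega
          rfl
        · exact h.symm
      · refine Or.inr fun p hp => ?_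
        rcases hle p hp with h' | rfl
        · obtain rfl : p = 0 := by omega
          rfl
        · exact h
    · have hback : f (n + 1) ≠ f (n - 1) := fun h => by
        have := hinj _ le_rfl _ (by omega) h
        omega
      rcases ih (fun p hp q hq => hinj p (by omega) q (by omega))
        (fun p hp => hstep p (by omega)) with h | h
      · refine Or.inl fun p hp => ?_
        have h₁ := h n le_rfl
        have h₂ := h (n - 1) (by omega)
        rcases hle p hp with h' | rfl
        · exact h p h'
        · omega
      · refine Or.inr fun p hp => ?_
        have h₁ := h n le_rfl
        have h₂ := h (n - 1) (by omega)
        rcases hle p hp with h' | rfl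
        · exact h p h'
        · omega

namespace PathSystem

/-- A path contained in a segment of a path is a segment. -/
theorem exists_segment_of_subset {W : PathSystem.{u}} {j : W.ι} {a b : ℕ} (hb : b ≤ W.len j)
    (P : InducedPath W.G) (hP : ∀ v ∈ P.verts, ∃ p, a ≤ p ∧ p ≤ b ∧ v = W.pt j p) :
    ∃ a' b', a ≤ a' ∧ a' ≤ b' ∧ b' ≤ b ∧ P.length = b' - a' ∧
      P.ends = {W.pt j a', W.pt j b'} ∧
      ∀ v, v ∈ P.verts ↔ ∃ p, a' ≤ p ∧ p ≤ b' ∧ v = W.pt j p := by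
  have hf : ∀ p, ∃ q, p ≤ P.length → a ≤ q ∧ q ≤ b ∧ P.seq p = W.pt j q := by
    intro p
    by_cases hp : p ≤ P.length
    · obtain ⟨q, hq⟩ := hP (P.seq p) (P.mem_verts_iff.mpr ⟨p, hp, rfl⟩)
      exact ⟨q, fun _ => hq⟩
    · exact ⟨0, fun h => absurd h hp⟩
  choose f hf using hf
  have hs := P.isPathSeq_seq
  have hj := W.isPathSeq j
  -- Consecutive vertices of `P` are adjacent on the `j`th path, so their positions differ by one;
  -- injectivity forbids turning back.
  have hmono := eq_add_or_add_eq_of_step (f := f) (n := P.length)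
    (fun p hp q hq h => hs.1 p hp q hq (by rw [(hf p hp).2.2, (hf q hq).2.2, h]))
    (fun p hp => by
      have h₁ := hf p hp.le
      have h₂ := hf (p + 1) hp
      have h := (hs.2 p hp.le (p + 1) hp).mpr (Or.inl rfl)
      rw [h₁.2.2, h₂.2.2] at h
      exact (hj.2 _ (h₁.2.1.trans hb) _ (h₂.2.1.trans hb)).mp h)
  have h0 := hf 0 (Nat.zero_le _)
  have hn := hf P.length le_rfl
  rcases hmono with h | h
  · have hn' := h P.length le_rfl
    refine ⟨f 0, f P.length, h0.1, by omega, hn.2.1, by omega, ?_, fun v => ?_⟩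
    · rw [P.ends_eq, h0.2.2, hn.2.2]
    · rw [P.mem_verts_iff]
      constructor
      · rintro ⟨p, hp, rfl⟩
        have := h p hp
        exact ⟨f p, by omega, by omega, (hf p hp).2.2⟩
      · rintro ⟨q, h₁, h₂, rfl⟩
        have := h (q - f 0) (by omega)
        refine ⟨q - f 0, by omega, ?_⟩
        rw [(hf (q - f 0) (by omega)).2.2, this]
        congr 1
        omega
  · have hn' := h P.length le_rfl
    refine ⟨f P.length, f 0, hn.1, by omega, h0.2.1, by omega, ?_, fun v => ?_⟩
    · rw [P.ends_eq, h0.2.2, hn.2.2, Set.pair_comm]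
    · rw [P.mem_verts_iff]
      constructor
      · rintro ⟨p, hp, rfl⟩
        have := h p hp
        exact ⟨f p, by omega, by omega, (hf p hp).2.2⟩
      · rintro ⟨q, h₁, h₂, rfl⟩
        have := h (f 0 - q) (by omega)
        refine ⟨f 0 - q, by omega, ?_⟩
        rw [(hf (f 0 - q) (by omega)).2.2]
        congr 1
        omega

/-- A sequence of vertices interrupting their predecessors on a link between the first two
yields a full occultation. -/
theorem exists_isFullOccultation {W : PathSystem.{u}} {o s : ℕ} {j : W.ι} {a b : ℕ}
    (hb : b ≤ W.len j) {x : ℕ → W.V} (hS : ∀ i < s + 2, x i ∈ W.S)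
    (hx : ∀ i < s + 2, ∀ k < s + 2, x i = x k → i = k)
    (hample : ∀ p, a ≤ p → p ≤ b → ∀ i < s + 2, ∀ k < s + 2,
      W.G.Adj (x i) (W.pt j p) → W.G.Adj (x k) (W.pt j p) → x i = x k)
    (hl : W.Link j a b (x 0) (x 1))
    (hint : ∀ i, 2 ≤ i → i < s + 2 → Interrupts o (x i) (x '' {k | k < i}) j a b) :
    ∃ A : OrderedAsterism W.G s, A.IsFullOccultation o := by
  have hab := hl.1
  have hLseq := isPathSeq_segment (W := W) hab hb
  let L : InducedPath W.G := hLseq.toInducedPath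
  have hLv : ∀ v, v ∈ L.verts ↔ ∃ p, a ≤ p ∧ p ≤ b ∧ v = W.pt j p := by
    intro v
    constructor
    · rintro ⟨i, rfl⟩
      have := i.isLt
      change i.val < b - a + 1 at this
      exact ⟨a + i.val, by omega, by omega, rfl⟩
    · rintro ⟨p, h₁, h₂, rfl⟩
      refine ⟨⟨p - a, show p - a < b - a + 1 by omega⟩, ?_⟩
      change W.pt j (a + (p - a)) = _
      congr 1
      omega
  have hLe : L.ends = {W.pt j a, W.pt j b} := by
    change {W.pt j (a + 0), W.pt j (a + (b - a))} = _
    rw [add_zero, show a + (b - a) = b by omega]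
  have hinj : ∀ p, p ≤ b → ∀ q, q ≤ b → W.pt j p = W.pt j q → p = q := fun p hp q hq =>
    (W.isPathSeq j).1 p (hp.trans hb) q (hq.trans hb)
  have h0 : ∀ p, a ≤ p → p ≤ b → (W.G.Adj (x 0) (W.pt j p) ↔ p = a) := fun p h₁ h₂ =>
    (hl.2 p h₁ h₂).1
  have h1 : ∀ p, a ≤ p → p ≤ b → (W.G.Adj (x 1) (W.pt j p) ↔ p = b) := fun p h₁ h₂ =>
    (hl.2 p h₁ h₂).2
  -- The ends of the segment are already neighbors of `x 0` and `x 1`, so ampleness keeps all later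
  -- terms away from them.
  have hk : ∀ k, 2 ≤ k → k < s + 2 → ¬ W.G.Adj (x k) (W.pt j a) ∧ ¬ W.G.Adj (x k) (W.pt j b) := by
    refine fun k hk₁ hk₂ => ⟨fun h => ?_, fun h => ?_⟩
    · have := hx _ hk₂ _ (by omega)
        (hample a le_rfl hab k hk₂ 0 (by omega) h ((h0 a le_rfl hab).mpr rfl))
      omega
    · have := hx _ hk₂ _ (by omega)
        (hample b hab le_rfl k hk₂ 1 (by omega) h ((h1 b hab le_rfl).mpr rfl))
      omega
  let A : OrderedAsterism W.G s :=
    { π := ⟨fun i => x (i.val + 2), fun i k h => Fin.ext (by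
        have := hx _ (by omega) _ (by omega) h
        omega)⟩
      L := L
      stable := by
        rintro _ ⟨i, rfl⟩ _ ⟨k, rfl⟩ _
        exact W.stable _ (hS _ (by omega)) _ (hS _ (by omega))
      disjoint := by
        refine Set.disjoint_left.mpr ?_
        rintro _ ⟨i, rfl⟩ hv
        obtain ⟨p, _, h₂, h⟩ := (hLv _).mp hv
        exact W.notMem j p (h₂.trans hb) (h ▸ hS (i.val + 2) (by omega))
      hasNeighbor := by
        intro i
        -- The whole path is a link between `x 0` and `x 1`, hence is hit by every later term.
        obtain ⟨p, h₁, h₂, h⟩ := (hint (i.val + 2) (by omega) (by omega)).1 (x 0)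
          ⟨0, show 0 < i.val + 2 by omega, rfl⟩ (x 1) ⟨1, show 1 < i.val + 2 by omega, rfl⟩
          (fun h => absurd (hx 0 (by omega) 1 (by omega) h) (by omega)) a b le_rfl le_rfl
          (Or.inl hl)
        have hki := hk (i.val + 2) (by omega) (by omega)
        refine ⟨W.pt j p, ⟨(hLv _).mpr ⟨p, h₁, h₂, rfl⟩, fun hp => ?_⟩, h⟩
        rw [hLe] at hp
        rcases hp with hp | hp
        · rw [hp] at h
          exact hki.1 h
        · rw [Set.mem_singleton_iff.mp hp] at h
          exact hki.2 h
      anticomplete_ends := by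
        rintro _ ⟨i, rfl⟩ v hv
        have hki := hk (i.val + 2) (by omega) (by omega)
        rw [hLe] at hv
        rcases hv with rfl | hv
        · exact hki.1
        · rw [Set.mem_singleton_iff.mp hv]
          exact hki.2 }
  have hbefore : ∀ (i : Fin s) (y : W.V), y ∈ A.before i ↔ ∃ k, 2 ≤ k ∧ k < i.val + 2 ∧ y = x k := by
    intro i y
    constructor
    · rintro ⟨k, hk, rfl⟩
      have : k.val < i.val := hk
      exact ⟨k.val + 2, by omega, by omega, rfl⟩
    · rintro ⟨k, h₁, h₂, rfl⟩
      refine ⟨⟨k - 2, by omega⟩, show k - 2 < i.val by omega, ?_⟩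
      change x (k - 2 + 2) = _
      congr 1
      omega
  have hpiece : ∀ (i : Fin s) (P : InducedPath W.G), IsPiece W.G (A.before i) A.L P →
      ∃ a' b', a ≤ a' ∧ a' < b' ∧ b' ≤ b ∧ P.length = b' - a' ∧
        P.ends = {W.pt j a', W.pt j b'} ∧
        (∀ p, a' ≤ p → p ≤ b' → W.pt j p ∈ P.verts) ∧
        ∀ p, a' < p → p < b' → ∀ k < i.val + 2, ¬ W.G.Adj (x k) (W.pt j p) := by
    rintro i P ⟨hPL, hlen, -, hanti⟩
    obtain ⟨a', b', ha', hab', hb', hlen', hends, hverts⟩ :=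
      exists_segment_of_subset hb P (fun v hv => (hLv v).mp (hPL hv))
    refine ⟨a', b', ha', by omega, hb', hlen', hends,
      fun p h₁ h₂ => (hverts _).mpr ⟨p, h₁, h₂, rfl⟩, fun p h₁ h₂ k hk h => ?_⟩
    by_cases hk2 : 2 ≤ k
    · refine hanti (W.pt j p) ⟨(hverts _).mpr ⟨p, h₁.le, h₂.le, rfl⟩, fun hp => ?_⟩ (x k)
        ((hbefore i _).mpr ⟨k, hk2, hk, rfl⟩) h.symm
      rw [hends] at hp
      rcases hp with hp | hp
      · have := hinj p (by omega) a' (by omega) hp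
        omega
      · have := hinj p (by omega) b' (by omega) (Set.mem_singleton_iff.mp hp)
        omega
    · obtain rfl | rfl : k = 0 ∨ k = 1 := by omega
      · have := (h0 p (by omega) (by omega)).mp h
        omega
      · have := (h1 p (by omega) (by omega)).mp h
        omega
  refine ⟨A, fun i k hik v hv ⟨hi, hk⟩ => ?_, fun i P hP => ?_, fun i P hP hlen => ?_⟩
  · obtain ⟨p, h₁, h₂, rfl⟩ := (hLv v).mp hv
    have := hx _ (by omega) _ (by omega)
      (hample p h₁ h₂ (i.val + 2) (by omega) (k.val + 2) (by omega) hi hk)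
    exact hik (Fin.ext (by omega))
  · obtain ⟨a', b', ha', hab', hb', -, hends, hverts, hmiss⟩ := hpiece i P hP.1
    -- An end of the piece that is also an end of the path is charged to `x 0` or `x 1`. The last
    -- two clauses ensure that if both ends are charged to the same term, it is neither of these, so
    -- it is a common neighbor in the stable set and the piece is not open.
    have hend : ∀ q, (q = a' ∨ q = b') → ∃ k < i.val + 2, W.G.Adj (x k) (W.pt j q) ∧
        (k = 0 → q = a) ∧ (k = 1 → q = b) := by
      intro q hq
      by_cases hqa : q = a
      · exact ⟨0, by omega, (h0 q (by omega) (by omega)).mpr hqa, fun _ => hqa, by omega⟩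
      · by_cases hqb : q = b
        · exact ⟨1, by omega, (h1 q (by omega) (by omega)).mpr hqb, by omega, fun _ => hqb⟩
        · obtain ⟨y, hy, hadj⟩ := hP.1.2.2.1 (W.pt j q)
            (by
              rw [hends]
              rcases hq with rfl | rfl <;> simp)
            (fun h => by
              change _ ∈ L.ends at h
              rw [hLe] at h
              rcases h with h | h
              · exact hqa (hinj q (by omega) a hab h)
              · exact hqb (hinj q (by omega) b le_rfl (Set.mem_singleton_iff.mp h)))
          obtain ⟨k, h₁, h₂, rfl⟩ := (hbefore i y).mp hy
          exact ⟨k, h₂, hadj.symm, by omega, by omega⟩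
    obtain ⟨k, hk, hka, hk0, hk1⟩ := hend a' (Or.inl rfl)
    obtain ⟨m, hm, hmb, hm0, hm1⟩ := hend b' (Or.inr rfl)
    have hkm : x k ≠ x m := by
      intro h
      obtain rfl := hx k (by omega) m (by omega) h
      refine hP.2 ⟨x k, (hbefore i _).mpr ⟨k, by omega, hk, rfl⟩, fun v hv => ?_⟩
      rw [hends] at hv
      rcases hv with rfl | hv
      · exact hka
      · rw [Set.mem_singleton_iff.mp hv]
        exact hmb
    suffices hlink : W.Link j a' b' (x k) (x m) by
      obtain ⟨p, h₁, h₂, h⟩ := (hint (i.val + 2) (by omega) (by omega)).1 (x k) ⟨k, hk, rfl⟩ (x m)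
        ⟨m, hm, rfl⟩ hkm a' b' ha' hb' (Or.inl hlink)
      exact ⟨W.pt j p, hverts p h₁ h₂, h⟩
    refine ⟨hab'.le, fun p h₁ h₂ => ⟨⟨fun h => ?_, ?_⟩, ⟨fun h => ?_, ?_⟩⟩⟩
    · by_contra hne
      rcases Nat.lt_or_ge p b' with hp | hp
      · exact hmiss p (by omega) hp k hk h
      · obtain rfl : p = b' := by omega
        exact hkm (hample p (by omega) (by omega) k (by omega) m (by omega) h hmb)
    · rintro rfl
      exact hka
    · by_contra hne
      rcases Nat.lt_or_ge a' p with hp | hp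
      · exact hmiss p hp (by omega) m hm h
      · obtain rfl : p = a' := by omega
        exact hkm (hample p (by omega) (by omega) k (by omega) m (by omega) hka h)
    · rintro rfl
      exact hmb
  · obtain ⟨a', b', ha', hab', hb', hlen', hends, hverts, hmiss⟩ := hpiece i P hP.1
    obtain ⟨y, hy, hadj⟩ := hP.2
    obtain ⟨k, hk2, hk, rfl⟩ := (hbefore i y).mp hy
    suffices hhole : W.Hole o j a' b' (x k) by
      obtain ⟨p, h₁, h₂, h⟩ := (hint (i.val + 2) (by omega) (by omega)).2 (x k) ⟨k, hk, rfl⟩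
        a' b' ha' hb' hhole
      exact ⟨W.pt j p, hverts p h₁ h₂, h⟩
    refine ⟨hab', by omega, fun p h₁ h₂ => ⟨fun h => ?_, ?_⟩⟩
    · by_contra hne
      exact hmiss p (by omega) (by omega) k hk h
    · rintro (rfl | rfl) <;> exact hadj _ (by rw [hends]; simp)

/-! ### Ampleness and the conclusion -/

open Classical in
/-- Unless `G` contains `K_{t,t}`, a large system has a large ample subsystem. -/
theorem exists_isAmpleOn (c o t n l : ℕ) (ht : 1 ≤ t) : ∃ N L : ℕ, ∀ W : PathSystem.{u},
    IsPerforated W.G c o → ¬ (completeBipartiteGraph (Fin t) (Fin t)).IsIndContained W.G →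
    ∀ (X : Finset W.V) (J : Finset W.ι), (X : Set W.V) ⊆ W.S →
    (∀ j ∈ J, ∀ x ∈ X, W.Hit j 0 (W.len j) x) → N ≤ X.card → L ≤ J.card →
    ∃ X' ⊆ X, n ≤ X'.card ∧ ∃ J' ⊆ J, l ≤ J'.card ∧ IsAmpleOn X' J' (fun _ => 0) W.len := by
  obtain ⟨N, L, h⟩ := exists_stable_of_linked.{u} c o t n l
  refine ⟨N, 2 ^ N * t + L, fun W hperf hK X₀ J hX₀S hit hX₀ hJ => ?_⟩
  obtain ⟨X, hXX₀, hXc⟩ := Finset.exists_subset_card_eq hX₀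
  have hXS : (X : Set W.V) ⊆ W.S := (Finset.coe_subset.mpr hXX₀).trans hX₀S
  let bad : W.ι → Prop := fun j => ∃ p, ∃ T ⊆ X, p ≤ W.len j ∧ T.card = t ∧
    ∀ x ∈ T, W.G.Adj x (W.pt j p)
  have hsplit : (J.filter bad).card + (J.filter (fun j => ¬ bad j)).card = J.card :=
    Finset.card_filter_add_card_filter_not _
  -- If many paths are bad, some `t` of them share the same set of `t` neighbors; the chosen
  -- vertices lie on different paths, so the `K_{t,t}` is induced.
  rcases le_or_gt (2 ^ N * t) (J.filter bad).card with hb | hb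
  · exfalso
    have hr : ∀ j ∈ J.filter bad, bad j := fun j hj => (Finset.mem_filter.mp hj).2
    simp only [bad] at hr
    choose! p T hTX hp hTc hT using hr
    obtain ⟨J', hJ', T₀, hT₀, hc, hφ⟩ := exists_large_fiber (J.filter bad) X.powerset T t
      (fun j hj => Finset.mem_powerset.mpr (hTX j hj)) ⟨∅, by simp⟩
      (by rwa [Finset.card_powerset, hXc])
    obtain ⟨ρ, hρJ, hρ⟩ := exists_seq_of_le_card J' t ht hc
    obtain ⟨e, heT, he⟩ := exists_seq_of_le_card T₀ t ht
      (by rw [← hφ _ (hρJ 0 ht), hTc _ (hJ' (hρJ 0 ht))])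
    have heS : ∀ i < t, e i ∈ W.S := fun i hi => hXS (Finset.mem_powerset.mp hT₀ (heT i hi))
    have hpl : ∀ i < t, p (ρ i) ≤ W.len (ρ i) := fun i hi => hp _ (hJ' (hρJ i hi))
    have hne : ∀ i < t, ∀ k < t, e i ≠ W.pt (ρ k) (p (ρ k)) := fun i hi k hk h =>
      W.notMem _ _ (hpl k hk) (h ▸ heS i hi)
    have hadj : ∀ i < t, ∀ k < t, W.G.Adj (e i) (W.pt (ρ k) (p (ρ k))) := fun i hi k hk =>
      hT _ (hJ' (hρJ k hk)) _ (by
        rw [hφ _ (hρJ k hk)]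
        exact heT i hi)
    have hsep : ∀ i < t, ∀ k < t, i ≠ k →
        W.pt (ρ i) (p (ρ i)) ≠ W.pt (ρ k) (p (ρ k)) ∧
          ¬ W.G.Adj (W.pt (ρ i) (p (ρ i))) (W.pt (ρ k) (p (ρ k))) := fun i hi k hk hik =>
      W.sep _ _ (fun h => hik (hρ i hi k hk h)) _ (hpl i hi) _ (hpl k hk)
    refine hK ⟨⟨⟨Sum.elim (fun i => e i.val) (fun k => W.pt (ρ k.val) (p (ρ k.val))), ?_⟩, ?_⟩⟩
    · rintro (i | i) (k | k) hik
      · exact congrArg Sum.inl (Fin.ext (he _ i.isLt _ k.isLt hik))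
      · exact absurd hik (hne _ i.isLt _ k.isLt)
      · exact absurd hik.symm (hne _ k.isLt _ i.isLt)
      · by_contra hne'
        exact (hsep _ i.isLt _ k.isLt (fun h => hne' (congrArg Sum.inr (Fin.ext h)))).1 hik
    · rintro (i | i) (k | k)
      · exact iff_of_false (W.stable _ (heS _ i.isLt) _ (heS _ k.isLt)) (by simp)
      · exact iff_of_true (hadj _ i.isLt _ k.isLt) (by simp)
      · exact iff_of_true (hadj _ k.isLt _ i.isLt).symm (by simp)
      · refine iff_of_false ?_ (by simp)
        by_cases hik : i = k
        · subst hik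
          exact W.G.irrefl
        · exact (hsep _ i.isLt _ k.isLt (fun h => hik (Fin.ext h))).2
  · have hgood : ∀ j ∈ J.filter (fun j => ¬ bad j), j ∈ J ∧ ∀ p ≤ W.len j, ∀ Y ⊆ X,
        (∀ w ∈ Y, W.G.Adj w (W.pt j p)) → Y.card ≤ t := by
      intro j hj
      have hj' := Finset.mem_filter.mp hj
      refine ⟨hj'.1, fun p hp Y hYX hY => ?_⟩
      by_contra! hc
      obtain ⟨T, hTY, hT⟩ := Finset.exists_subset_card_eq hc.le
      exact hj'.2 ⟨p, T, hTY.trans hYX, hp, hT, fun x hx => hY x (hTY hx)⟩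
    obtain ⟨X', hX', hn, J', hJ', hl, hst⟩ := h W hperf X (J.filter (fun j => ¬ bad j))
      (fun j y z => ∃ p ≤ W.len j, W.G.Adj y (W.pt j p) ∧ W.G.Adj z (W.pt j p)) hXS
      (fun j y z ⟨p, hp, hy, hz⟩ => ⟨p, hp, hz, hy⟩)
      (fun j hj y _ z _ _ ⟨p, hp, hy, hz⟩ => by
        -- A common neighbor is a link of length zero, hit by at most `t` vertices on a path that is
        -- not bad.
        refine ⟨p, p, hp, Or.inl ⟨le_rfl, fun q h₁ h₂ => ?_⟩, fun Y hYX hY =>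
          (hgood j hj).2 p hp Y hYX fun w hw => ?_⟩
        · obtain rfl : q = p := by omega
          simp [hy, hz]
        · obtain ⟨q, h₁, h₂, h⟩ := hY w hw
          obtain rfl : q = p := by omega
          exact h) hXc.ge (by omega)
    have hJ'J : J' ⊆ J := hJ'.trans (Finset.filter_subset _ _)
    refine ⟨X', hX'.trans hXX₀, hn, J', hJ'J, hl, (Finset.coe_subset.mpr hX').trans hXS,
      fun _ _ => le_rfl, fun j hj x hx => hit j (hJ'J hj) x (hXX₀ (hX' hx)),
      fun j hj p _ hp x hx y hy hpx hpy => ?_⟩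
    by_contra hxy
    exact hst j hj x hx y hy hxy ⟨p, hp, hpx, hpy⟩

/-- The path system underlying a plain constellation. -/
def ofConstellation {V : Type u} {G : SimpleGraph V} {σ l : ℕ} (C : Constellation G σ l)
    (hC : C.IsPlain) : PathSystem.{u} where
  V := V
  G := G
  S := C.S
  ι := Fin l
  len i := (C.paths i).length
  pt i := (C.paths i).seq
  stable _ hx _ hy h := C.stable hx hy h.ne h
  isPathSeq i := (C.paths i).isPathSeq_seq
  sep i j hij p hp q hq :=
    have hp' := (C.paths i).mem_verts_iff.mpr ⟨p, hp, rfl⟩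
    have hq' := (C.paths j).mem_verts_iff.mpr ⟨q, hq, rfl⟩
    ⟨fun h => Set.disjoint_left.mp (C.paths_disjoint i j hij) hp' (h ▸ hq'),
      hC i j hij _ hp' _ hq'⟩
  notMem i p hp h := Set.disjoint_left.mp (C.S_disjoint i) h
    ((C.paths i).mem_verts_iff.mpr ⟨p, hp, rfl⟩)

end PathSystem
end PerforatedGraphs

open PerforatedGraphs in
theorem theorem6p1 (c o t s : ℕ) (hc : 1 ≤ c) (ho : 1 ≤ o) (ht : 1 ≤ t) :
    ∃ σ l : ℕ, 1 ≤ l ∧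
      ∀ (V : Type*) [Finite V] (G : SimpleGraph V),
        PerforatedGraphs.IsPerforated G c o →
        (∃ C : PerforatedGraphs.Constellation G σ l, C.IsPlain) →
        (SimpleGraph.completeGraph (Fin t)).IsIndContained G ∨
        (completeBipartiteGraph (Fin t) (Fin t)).IsIndContained G ∨
        ∃ a : PerforatedGraphs.OrderedAsterism G s, a.IsFullOccultation o := by
  obtain ⟨N₁, L₁, h₁⟩ := PathSystem.exists_interrupting_seq c o s
  obtain ⟨N₂, L₂, h₂⟩ := PathSystem.exists_isAmpleOn c o t N₁ L₁ ht
  -- The successor guarantees at least one path; the clique alternative is never used.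
  refine ⟨N₂, L₂ + 1, by omega, fun V _ G hperf ⟨C, hC⟩ => Or.inr ?_⟩
  by_cases hK : (completeBipartiteGraph (Fin t) (Fin t)).IsIndContained G
  · exact Or.inl hK
  let W := PathSystem.ofConstellation C hC
  obtain ⟨X, -, hX, J, -, hJ, hsys⟩ := h₂ W hperf hK C.S (Finset.univ : Finset (Fin (L₂ + 1)))
    subset_rfl (fun j _ x hx => by
      obtain ⟨y, hy, hxy⟩ := C.hasNeighbor x hx j
      obtain ⟨p, hp, rfl⟩ := (C.paths j).mem_verts_iff.mp hy
      exact ⟨p, Nat.zero_le _, hp, hxy⟩) C.card_S.ge (by simp [W, PathSystem.ofConstellation])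
  obtain ⟨j, hj, a, b, ha, hb, x, hxX, hx, hl, hint⟩ := h₁ W hperf X J _ _ hsys hX hJ
  exact Or.inr (PathSystem.exists_isFullOccultation (W := W) hb (fun i hi => hsys.subset (hxX i hi))
    hx (fun p h₁ h₂ i hi k hk => hsys.ample j hj p (ha.trans h₁) (h₂.trans hb) _ (hxX i hi) _
      (hxX k hk)) hl hint)
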